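/- Let $(\gamma_i)_{i=1}^d$ be independent standard real-valued Gaussian random variables (mean $0$, variance $1$) on a probability space $(\Omega,\mathbb P)$, let $n,d\in\mathbb N$, and let $C_1,\dots,C_d\in M_n(\mathbb C)$. Write $\|A\|_{S_1^n}=\operatorname{Tr}\big((A^*A)^{1/2}\big)$ for the trace norm on $M_n(\mathbb C)$ ($\operatorname{Tr}$ the unnormalized trace), and $$\|(C_i)\|_{S_1^n(\ell_2^{rc})}=\inf\Big\{\Big\|\Big(\sum_{i=1}^d X_i^*X_i\Big)^{1/2}\Big\|_{S_1^n}+\Big\|\Big(\sum_{i=1}^d Y_iY_i^*\Big)^{1/2}\Big\|_{S_1^n}\Big\},$$ the infimum being over all $X_1,\dots,X_d,Y_1,\dots,Y_d\in M_n(\mathbb C)$ with $C_i=X_i+Y_i$ for $1\le i\le d$. Then $\omega\mapsto\big\|\sum_{i=1}^d\gamma_i(\omega)C_i\big\|_{S_1^n}$ is integrable and $$\frac1{\sqrt3}\,\|(C_i)\|_{S_1^n(\ell_2^{rc})}\;\le\;\Big\|\sum_{i=1}^d C_i\otimes\gamma_i\Big\|_{L_1(\Omega;S_1^n)}=\int_\Omega\Big\|\sum_{i=1}^d\gamma_i(\omega)C_i\Big\|_{S_1^n}\,d\mathbb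 P(\omega)\;\le\;\|(C_i)\|_{S_1^n(\ell_2^{rc})}.$$ -/

import Mathlib

noncomputable section

section SchattenNorms

open scoped MatrixOrder ComplexOrder

/-- The trace norm `‖A‖_{S_1^n} = Tr ((A* A)^{1/2})` on `M_n(ℂ)`, with the unnormalized trace.
The trace of the positive semidefinite matrix `(A* A)^{1/2}` is a nonnegative real number. -/
def traceNorm {n : ℕ} (A : Matrix (Fin n) (Fin n) ℂ) : ℝ :=
  (CFC.sqrt (A.conjTranspose * A)).trace.re

/-- The column norm `‖(∑ X_i* X_i)^{1/2}‖_{S_1^n}`. -/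
def columnNorm {n d : ℕ} (X : Fin d → Matrix (Fin n) (Fin n) ℂ) : ℝ :=
  traceNorm (CFC.sqrt (∑ i, (X i).conjTranspose * X i))

/-- The row norm `‖(∑ Y_i Y_i*)^{1/2}‖_{S_1^n}`. -/
def rowNorm {n d : ℕ} (Y : Fin d → Matrix (Fin n) (Fin n) ℂ) : ℝ :=
  traceNorm (CFC.sqrt (∑ i, Y i * (Y i).conjTranspose))

/-- The norm of `S_1^n(ℓ_2^{rc})`: the infimum of `columnNorm X + rowNorm Y` over all
decompositions `C_i = X_i + Y_i`. -/
def rowColumnNorm {n d : ℕ} (C : Fin d → Matrix (Fin n) (Fin n) ℂ) : ℝ :=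
  sInf {r : ℝ | ∃ X Y : Fin d → Matrix (Fin n) (Fin n) ℂ,
    (∀ i, C i = X i + Y i) ∧ r = columnNorm X + rowNorm Y}

end SchattenNorms

end

open scoped MatrixOrder ComplexOrder
open Matrix

/-! Upper bound: in an orthonormal basis `b` of right singular vectors of a column `X`, the trace
norm of `∑ γ_i X_i` is at most `∑ₖ ‖∑ γ_i X_i bₖ‖`. By Jensen and orthonormality of the `γ_i`, the
k-th term has mean at most the k-th singular value, and these sum to the column norm. Adjoints give
the row case, and the triangle inequality the infimum.

Lower bound: Hahn–Banach and trace duality give matrices `a_i` with `∑ a_i* a_i ≤ 1`, `∑ a_i a_i* ≤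
1` and `Re ∑ Tr (a_i C_i) = ‖C‖`, where `‖C‖` is the row-column norm. With `S = ∑ γ_i a_i` and `G =
∑ γ_j C_j`, orthonormality turns this into `E Re Tr (S G) = ‖C‖`. Since `S` is unbounded, split it
as `F + R` with `F = 3S(3 + S*S)⁻¹`. As `3s/(3 + s²) ≤ √3/2`, the part `F` contributes at most
`(√3/2) E‖G‖`.

The part `R` acts on `C` only through `b_j = E(γ_j R)`. By Bessel, `∑ ‖b_j v‖² ≤ E‖R v‖²`; as `s³/(3
+ s²) ≤ s²/√12`, this is at most `E‖S*S v‖²/12`. Wick's formula bounds the fourth moment by `3‖v‖²`,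
so `∑ ‖b_j v‖² ≤ ‖v‖²/4`, and likewise for adjoints. Hence `‖C‖ ≤ (√3/2) E‖G‖ + ‖C‖/2`, which is the
claim. With a parameter `λ` in place of 3 in `F`, the same argument gives the constant `λ/(2√λ -
√3)`, which is least at `λ = 3`. -/

/-- The operator on Euclidean space given by a matrix. -/
noncomputable abbrev Matrix.op {n : ℕ} (A : Matrix (Fin n) (Fin n) ℂ) :
    EuclideanSpace ℂ (Fin n) →L[ℂ] EuclideanSpace ℂ (Fin n) :=
  Matrix.toEuclideanCLM (n := Fin n) (𝕜 := ℂ) A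

/-! ### Trace, column and row norms and their trace pairing -/

section LinearAlgebra

variable {n : ℕ}

theorem op_conjTranspose (A : Matrix (Fin n) (Fin n) ℂ) :
    op A.conjTranspose = ContinuousLinearMap.adjoint (op A) := by
  rw [← ContinuousLinearMap.star_eq_adjoint, ← Matrix.star_eq_conjTranspose]
  exact map_star (Matrix.toEuclideanCLM (n := Fin n) (𝕜 := ℂ)) A

theorem op_mul_apply (A B : Matrix (Fin n) (Fin n) ℂ) (v : EuclideanSpace ℂ (Fin n)) :
    op (A * B) v = op A (op B v) := by
  simp [op]

theorem inner_op_conjTranspose_left (A : Matrix (Fin n) (Fin n) ℂ)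
    (v w : EuclideanSpace ℂ (Fin n)) : inner ℂ (op A.conjTranspose v) w = inner ℂ v (op A w) := by
  rw [op_conjTranspose, ContinuousLinearMap.adjoint_inner_left]

theorem inner_op_conjTranspose_right (A : Matrix (Fin n) (Fin n) ℂ)
    (v w : EuclideanSpace ℂ (Fin n)) : inner ℂ v (op A.conjTranspose w) = inner ℂ (op A v) w := by
  rw [op_conjTranspose, ContinuousLinearMap.adjoint_inner_right]

theorem norm_op_sq (A : Matrix (Fin n) (Fin n) ℂ) (v : EuclideanSpace ℂ (Fin n)) :
    ((‖op A v‖ ^ 2 : ℝ) : ℂ) = inner ℂ v (op (A.conjTranspose * A) v) := by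
  rw [op_mul_apply, inner_op_conjTranspose_right, inner_self_eq_norm_sq_to_K]
  simp

theorem trace_eq_sum_inner_op (A : Matrix (Fin n) (Fin n) ℂ)
    (b : OrthonormalBasis (Fin n) ℂ (EuclideanSpace ℂ (Fin n))) :
    A.trace = ∑ k, inner ℂ (b k) (op A (b k)) := by
  have h := LinearMap.trace_eq_sum_inner (op A : _ →ₗ[ℂ] _) b
  have h2 : LinearMap.trace ℂ _ (op A : EuclideanSpace ℂ (Fin n) →ₗ[ℂ] _) = A.trace := by
    rw [Matrix.coe_toEuclideanCLM_eq_toEuclideanLin, Matrix.toEuclideanLin,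
      Matrix.toLpLin_eq_toLin]
    exact Matrix.trace_toLin_eq A _
  rw [← h2, h]
  rfl

/-- Diagonalizing the square root rather than `H` makes the `q k` its eigenvalues, so that their sum
is its trace. -/
theorem exists_orthonormalBasis_sqrt {H : Matrix (Fin n) (Fin n) ℂ} (hH : H.PosSemidef) :
    ∃ (b : OrthonormalBasis (Fin n) ℂ (EuclideanSpace ℂ (Fin n))) (q : Fin n → ℝ),
      (∀ k, 0 ≤ q k) ∧ (∀ k, op H (b k) = ((q k ^ 2 : ℝ) : ℂ) • b k) ∧
      (CFC.sqrt H).trace.re = ∑ k, q k := by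
  have hQ : (CFC.sqrt H).PosSemidef := Matrix.nonneg_iff_posSemidef.1 (CFC.sqrt_nonneg H)
  have hQQ : CFC.sqrt H * CFC.sqrt H = H := CFC.sqrt_mul_sqrt_self H hH.nonneg
  have hev : ∀ k, op (CFC.sqrt H) (hQ.1.eigenvectorBasis k) =
      (hQ.1.eigenvalues k : ℂ) • hQ.1.eigenvectorBasis k := by
    intro k
    ext i
    have := congrFun (hQ.1.mulVec_eigenvectorBasis k) i
    simpa [op] using this
  refine ⟨hQ.1.eigenvectorBasis, hQ.1.eigenvalues, hQ.eigenvalues_nonneg, fun k => ?_, ?_⟩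
  · have h : ∀ v, op H v = op (CFC.sqrt H) (op (CFC.sqrt H) v) := fun v => by
      rw [← op_mul_apply, hQQ]
    rw [h, hev, map_smul, hev, smul_smul]
    push_cast
    rw [sq]
  · rw [hQ.1.trace_eq_sum_eigenvalues]
    simp

theorem trace_sqrt_nonneg (H : Matrix (Fin n) (Fin n) ℂ) : 0 ≤ (CFC.sqrt H).trace.re :=
  (Complex.nonneg_iff.1 (Matrix.nonneg_iff_posSemidef.1 (CFC.sqrt_nonneg H)).trace_nonneg).1

theorem traceNorm_sqrt {H : Matrix (Fin n) (Fin n) ℂ} (hH : H.PosSemidef) :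
    traceNorm (CFC.sqrt H) = (CFC.sqrt H).trace.re := by
  have hQ : (CFC.sqrt H).PosSemidef := Matrix.nonneg_iff_posSemidef.1 (CFC.sqrt_nonneg H)
  rw [traceNorm, hQ.1.eq, CFC.sqrt_mul_sqrt_self H hH.nonneg]

theorem posSemidef_sum_conjTranspose_mul_self {d : ℕ} (X : Fin d → Matrix (Fin n) (Fin n) ℂ) :
    (∑ i, (X i).conjTranspose * X i).PosSemidef :=
  Matrix.posSemidef_sum _ fun i _ => Matrix.posSemidef_conjTranspose_mul_self (X i)

theorem columnNorm_nonneg {d : ℕ} (X : Fin d → Matrix (Fin n) (Fin n) ℂ) : 0 ≤ columnNorm X :=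
  trace_sqrt_nonneg _

theorem rowNorm_eq_columnNorm {d : ℕ} (Y : Fin d → Matrix (Fin n) (Fin n) ℂ) :
    rowNorm Y = columnNorm fun i => (Y i).conjTranspose := by
  simp [rowNorm, columnNorm]

theorem rowNorm_nonneg {d : ℕ} (X : Fin d → Matrix (Fin n) (Fin n) ℂ) : 0 ≤ rowNorm X :=
  trace_sqrt_nonneg _

/-- The trace norm is the column norm of length one, so trace-norm facts are special cases of column
facts. -/
theorem columnNorm_fin_one (A : Matrix (Fin n) (Fin n) ℂ) :
    columnNorm (fun _ : Fin 1 => A) = traceNorm A := by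
  rw [columnNorm, traceNorm_sqrt (posSemidef_sum_conjTranspose_mul_self _)]
  simp [traceNorm]

theorem sum_norm_op_sq {d : ℕ} (X : Fin d → Matrix (Fin n) (Fin n) ℂ)
    (v : EuclideanSpace ℂ (Fin n)) :
    ((∑ i, ‖op (X i) v‖ ^ 2 : ℝ) : ℂ) = inner ℂ v (op (∑ i, (X i).conjTranspose * X i) v) := by
  rw [Complex.ofReal_sum, op, map_sum, _root_.sum_apply, inner_sum]
  exact Finset.sum_congr rfl fun i _ => norm_op_sq _ _

/-- An orthonormal basis of right singular vectors of the column `X`, with singular values `q`. -/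
theorem exists_orthonormalBasis_columnNorm {d : ℕ} (X : Fin d → Matrix (Fin n) (Fin n) ℂ) :
    ∃ (b : OrthonormalBasis (Fin n) ℂ (EuclideanSpace ℂ (Fin n))) (q : Fin n → ℝ),
      (∀ k, 0 ≤ q k) ∧
      (∀ k, op (∑ i, (X i).conjTranspose * X i) (b k) = ((q k ^ 2 : ℝ) : ℂ) • b k) ∧
      (∀ k, ∑ i, ‖op (X i) (b k)‖ ^ 2 = q k ^ 2) ∧ columnNorm X = ∑ k, q k := by
  obtain ⟨b, q, h0, h1, h2⟩ :=
    exists_orthonormalBasis_sqrt (posSemidef_sum_conjTranspose_mul_self X)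
  refine ⟨b, q, h0, h1, fun k => ?_, ?_⟩
  · have := sum_norm_op_sq X (b k)
    rw [h1, inner_smul_right, inner_self_eq_norm_sq_to_K] at this
    simp only [OrthonormalBasis.norm_eq_one] at this
    rw [← Complex.ofReal_inj, this]
    simp
  · rw [columnNorm, traceNorm_sqrt (posSemidef_sum_conjTranspose_mul_self _), h2]

/-- Expand the trace in `b` and apply Cauchy–Schwarz for each basis vector. The basis is arbitrary:
singular vectors yield the column norm, while any other basis yields `traceNorm_le_sum_norm`. -/
theorem re_sum_trace_mul_le_sum {ι : Type*} [Fintype ι] (a X : ι → Matrix (Fin n) (Fin n) ℂ)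
    {c : ℝ} (hc : 0 ≤ c) (ha : ∀ v, ∑ i, ‖op (a i).conjTranspose v‖ ^ 2 ≤ c ^ 2 * ‖v‖ ^ 2)
    (b : OrthonormalBasis (Fin n) ℂ (EuclideanSpace ℂ (Fin n))) :
    (∑ i, (a i * X i).trace).re ≤ c * ∑ k, √(∑ i, ‖op (X i) (b k)‖ ^ 2) := by
  have h1 : (∑ i, (a i * X i).trace).re =
      ∑ k, ∑ i, (inner ℂ (op (a i).conjTranspose (b k)) (op (X i) (b k))).re := by
    simp_rw [trace_eq_sum_inner_op _ b, op_mul_apply, inner_op_conjTranspose_left]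
    rw [Finset.sum_comm]
    simp
  rw [h1, Finset.mul_sum]
  refine Finset.sum_le_sum fun k _ => ?_
  calc ∑ i, (inner ℂ (op (a i).conjTranspose (b k)) (op (X i) (b k))).re
      ≤ ∑ i, ‖op (a i).conjTranspose (b k)‖ * ‖op (X i) (b k)‖ :=
        Finset.sum_le_sum fun i _ => re_inner_le_norm (𝕜 := ℂ) _ _
    _ ≤ √(∑ i, ‖op (a i).conjTranspose (b k)‖ ^ 2) * √(∑ i, ‖op (X i) (b k)‖ ^ 2) :=
        Real.sum_mul_le_sqrt_mul_sqrt _ _ _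
    _ ≤ c * √(∑ i, ‖op (X i) (b k)‖ ^ 2) := by
        gcongr
        rw [Real.sqrt_le_iff]
        refine ⟨hc, (ha (b k)).trans ?_⟩
        simp

theorem re_sum_trace_mul_le_columnNorm {d : ℕ} (a X : Fin d → Matrix (Fin n) (Fin n) ℂ)
    {c : ℝ} (hc : 0 ≤ c) (ha : ∀ v, ∑ i, ‖op (a i).conjTranspose v‖ ^ 2 ≤ c ^ 2 * ‖v‖ ^ 2) :
    (∑ i, (a i * X i).trace).re ≤ c * columnNorm X := by
  obtain ⟨b, q, h0, -, h2, h3⟩ := exists_orthonormalBasis_columnNorm X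
  refine (re_sum_trace_mul_le_sum a X hc ha b).trans (le_of_eq ?_)
  rw [h3]
  simp_rw [h2, Real.sqrt_sq (h0 _)]

/-- Polar decomposition: with `H = ∑ X_i* X_i` and `W` the pseudo-inverse of `H^{1/2}`, the choice
`a_i = W X_i*` gives `∑ a_i X_i = W H = H^{1/2}`. -/
theorem exists_re_sum_trace_mul_eq_columnNorm {d : ℕ} (X : Fin d → Matrix (Fin n) (Fin n) ℂ) :
    ∃ a : Fin d → Matrix (Fin n) (Fin n) ℂ,
      (∀ v, ∑ i, ‖op (a i).conjTranspose v‖ ^ 2 ≤ ‖v‖ ^ 2) ∧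
      (∑ i, (a i * X i).trace).re = columnNorm X := by
  obtain ⟨b, q, h0, h1, h2, h3⟩ := exists_orthonormalBasis_columnNorm X
  set H := ∑ i, (X i).conjTranspose * X i with hH
  -- On the kernel of `H` the convention `0⁻¹ = 0` makes this the pseudo-inverse.
  let T : EuclideanSpace ℂ (Fin n) →L[ℂ] EuclideanSpace ℂ (Fin n) :=
    ∑ k, (((q k)⁻¹ : ℝ) : ℂ) • (innerSL ℂ (b k)).smulRight (b k)
  have hT : ∀ v, T v = ∑ k, (((q k)⁻¹ : ℝ) : ℂ) • inner ℂ (b k) v • b k := by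
    intro v
    simp [T]
  let W : Matrix (Fin n) (Fin n) ℂ := (Matrix.toEuclideanCLM (n := Fin n) (𝕜 := ℂ)).symm T
  have hW : op W = T := by simp [op, W]
  have hWb : ∀ k, T (b k) = (((q k)⁻¹ : ℝ) : ℂ) • b k := by
    intro k
    rw [hT, Finset.sum_eq_single k]
    · simp
    · intro j _ hj
      simp [b.inner_eq_ite, hj]
    · simp
  refine ⟨fun i => W * (X i).conjTranspose, fun v => ?_, ?_⟩
  · have hcoef : ∀ k, ‖inner ℂ (b k) (op W.conjTranspose v)‖ ^ 2 =
        (q k)⁻¹ ^ 2 * ‖inner ℂ (b k) v‖ ^ 2 := by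
      intro k
      rw [inner_op_conjTranspose_right, hW, hWb, inner_smul_left, norm_mul, mul_pow]
      simp
    have hHw : ∀ w, (∑ i, ‖op (X i) w‖ ^ 2) = ∑ k, q k ^ 2 * ‖inner ℂ (b k) w‖ ^ 2 := by
      intro w
      rw [← Complex.ofReal_inj, sum_norm_op_sq, ← hH, ← b.sum_inner_mul_inner, Complex.ofReal_sum]
      refine Finset.sum_congr rfl fun k _ => ?_
      rw [← inner_op_conjTranspose_left,
        (posSemidef_sum_conjTranspose_mul_self X).isHermitian.eq, ← hH, h1, inner_smul_left,
        ← inner_conj_symm w (b k)]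
      push_cast
      rw [← Complex.conj_mul']
      simp
      ring
    have : ∀ i, op (W * (X i).conjTranspose).conjTranspose v = op (X i) (op W.conjTranspose v) := by
      intro i
      rw [Matrix.conjTranspose_mul, Matrix.conjTranspose_conjTranspose, op_mul_apply]
    simp_rw [this]
    rw [hHw, ← b.sum_sq_norm_inner_right v]
    refine Finset.sum_le_sum fun k _ => ?_
    rw [hcoef, ← mul_assoc, ← mul_pow]
    refine mul_le_of_le_one_left (by positivity) ?_
    by_cases h : q k = 0
    · simp [h]
    · simp [h]
  · simp_rw [mul_assoc, ← Matrix.trace_sum, ← Finset.mul_sum, ← hH]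
    rw [trace_eq_sum_inner_op _ b, h3, Complex.re_sum]
    refine Finset.sum_congr rfl fun k _ => ?_
    rw [op_mul_apply, h1, map_smul, hW, hWb, smul_smul, inner_smul_right]
    rw [b.inner_eq_ite, if_pos rfl, mul_one, ← Complex.ofReal_mul, Complex.ofReal_re]
    by_cases h : q k = 0
    · simp [h]
    · field_simp

/-- A functional norming `X + Y` lies in the dual unit ball, so it is at most the norm on each
summand. -/
theorem columnNorm_add_le {d : ℕ} (X Y : Fin d → Matrix (Fin n) (Fin n) ℂ) :
    columnNorm (X + Y) ≤ columnNorm X + columnNorm Y := by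
  obtain ⟨a, ha, h⟩ := exists_re_sum_trace_mul_eq_columnNorm (X + Y)
  rw [← h]
  have ha' : ∀ v, ∑ i, ‖op (a i).conjTranspose v‖ ^ 2 ≤ (1 : ℝ) ^ 2 * ‖v‖ ^ 2 := by simpa using ha
  have h1 := re_sum_trace_mul_le_columnNorm a X zero_le_one ha'
  have h2 := re_sum_trace_mul_le_columnNorm a Y zero_le_one ha'
  simp only [Pi.add_apply, mul_add, Matrix.trace_add, Finset.sum_add_distrib, Complex.add_re]
  linarith

theorem columnNorm_smul_le {d : ℕ} (X : Fin d → Matrix (Fin n) (Fin n) ℂ) (t : ℝ) :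
    columnNorm (t • X) ≤ |t| * columnNorm X := by
  obtain ⟨a, ha, h⟩ := exists_re_sum_trace_mul_eq_columnNorm (t • X)
  have ha' : ∀ v, ∑ i, ‖op (t • a i).conjTranspose v‖ ^ 2 ≤ |t| ^ 2 * ‖v‖ ^ 2 := by
    intro v
    have : ∀ i, ‖op (t • a i).conjTranspose v‖ ^ 2 = |t| ^ 2 * ‖op (a i).conjTranspose v‖ ^ 2 := by
      intro i
      have : (t • a i).conjTranspose = (t : ℂ) • (a i).conjTranspose := by
        ext; simp
      rw [this, op, map_smul, _root_.smul_apply, norm_smul, mul_pow]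
      simp
    simp_rw [this, ← Finset.mul_sum]
    gcongr
    exact ha v
  rw [← h]
  refine le_trans (le_of_eq ?_) (re_sum_trace_mul_le_columnNorm _ X (abs_nonneg t) ha')
  simp

theorem columnNorm_smul {d : ℕ} (X : Fin d → Matrix (Fin n) (Fin n) ℂ) {t : ℝ} (ht : 0 < t) :
    columnNorm (t • X) = t * columnNorm X := by
  refine le_antisymm (by simpa [abs_of_pos ht] using columnNorm_smul_le X t) ?_
  have := columnNorm_smul_le (t • X) t⁻¹
  rw [inv_smul_smul₀ ht.ne', abs_of_pos (inv_pos.2 ht)] at this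
  rwa [inv_mul_eq_div, le_div_iff₀' ht] at this

theorem rowNorm_add_le {d : ℕ} (X Y : Fin d → Matrix (Fin n) (Fin n) ℂ) :
    rowNorm (X + Y) ≤ rowNorm X + rowNorm Y := by
  simp only [rowNorm_eq_columnNorm, Pi.add_apply, Matrix.conjTranspose_add]
  exact columnNorm_add_le _ _

theorem rowNorm_smul {d : ℕ} (X : Fin d → Matrix (Fin n) (Fin n) ℂ) {t : ℝ} (ht : 0 < t) :
    rowNorm (t • X) = t * rowNorm X := by
  rw [rowNorm_eq_columnNorm, rowNorm_eq_columnNorm, ← columnNorm_smul _ ht]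
  congr 1
  ext
  simp

theorem re_sum_trace_mul_le_rowNorm {d : ℕ} (a Y : Fin d → Matrix (Fin n) (Fin n) ℂ)
    {c : ℝ} (hc : 0 ≤ c) (ha : ∀ v, ∑ i, ‖op (a i) v‖ ^ 2 ≤ c ^ 2 * ‖v‖ ^ 2) :
    (∑ i, (a i * Y i).trace).re ≤ c * rowNorm Y := by
  rw [rowNorm_eq_columnNorm]
  refine le_trans (le_of_eq ?_) (re_sum_trace_mul_le_columnNorm (fun i => (a i).conjTranspose) _ hc
    (by simpa using ha))
  simp_rw [← Matrix.conjTranspose_mul, Matrix.trace_conjTranspose, Complex.re_sum,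
    Matrix.trace_mul_comm (a _)]
  simp

/-! ### The row-column norm as a sublinear functional -/

theorem bddBelow_rowColumnNorm {d : ℕ} (C : Fin d → Matrix (Fin n) (Fin n) ℂ) :
    BddBelow {r : ℝ | ∃ X Y : Fin d → Matrix (Fin n) (Fin n) ℂ,
    (∀ i, C i = X i + Y i) ∧ r = columnNorm X + rowNorm Y} :=
  ⟨0, by rintro _ ⟨X, Y, -, rfl⟩; exact add_nonneg (columnNorm_nonneg X) (rowNorm_nonneg Y)⟩

theorem rowColumnNorm_add_le_columnNorm_add_rowNorm {d : ℕ}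
    (X Y : Fin d → Matrix (Fin n) (Fin n) ℂ) :
    rowColumnNorm (X + Y) ≤ columnNorm X + rowNorm Y :=
  csInf_le (bddBelow_rowColumnNorm _) ⟨X, Y, fun _ => rfl, rfl⟩

theorem le_rowColumnNorm {d : ℕ} {C : Fin d → Matrix (Fin n) (Fin n) ℂ} {r : ℝ}
    (h : ∀ X Y, C = X + Y → r ≤ columnNorm X + rowNorm Y) : r ≤ rowColumnNorm C := by
  refine le_csInf ⟨_, C, 0, by simp, rfl⟩ ?_
  rintro _ ⟨X, Y, hXY, rfl⟩
  exact h X Y (funext hXY)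

theorem rowColumnNorm_add_le {d : ℕ} (C D : Fin d → Matrix (Fin n) (Fin n) ℂ) :
    rowColumnNorm (C + D) ≤ rowColumnNorm C + rowColumnNorm D := by
  rw [← sub_le_iff_le_add]
  refine le_rowColumnNorm fun X Y hC => ?_
  rw [sub_le_comm]
  refine le_rowColumnNorm fun X' Y' hD => ?_
  have := rowColumnNorm_add_le_columnNorm_add_rowNorm (X + X') (Y + Y')
  rw [hC, hD, add_add_add_comm]
  linarith [columnNorm_add_le X X', rowNorm_add_le Y Y']

theorem rowColumnNorm_smul_le {d : ℕ} (C : Fin d → Matrix (Fin n) (Fin n) ℂ) {t : ℝ}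
    (ht : 0 < t) : rowColumnNorm (t • C) ≤ t * rowColumnNorm C := by
  rw [← div_le_iff₀' ht]
  refine le_rowColumnNorm fun X Y hC => ?_
  rw [div_le_iff₀' ht, mul_add, ← columnNorm_smul _ ht, ← rowNorm_smul _ ht, hC, smul_add]
  exact rowColumnNorm_add_le_columnNorm_add_rowNorm _ _

theorem rowColumnNorm_smul {d : ℕ} (t : ℝ) (ht : 0 < t)
    (C : Fin d → Matrix (Fin n) (Fin n) ℂ) : rowColumnNorm (t • C) = t * rowColumnNorm C := by
  refine le_antisymm (rowColumnNorm_smul_le C ht) ?_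
  have := rowColumnNorm_smul_le (t • C) (inv_pos.2 ht)
  rwa [inv_smul_smul₀ ht.ne', inv_mul_eq_div, le_div_iff₀' ht] at this

theorem rowColumnNorm_nonneg {d : ℕ} (C : Fin d → Matrix (Fin n) (Fin n) ℂ) :
    0 ≤ rowColumnNorm C :=
  le_rowColumnNorm fun X Y _ => add_nonneg (columnNorm_nonneg X) (rowNorm_nonneg Y)

theorem re_sum_trace_mul_le_rowColumnNorm {d : ℕ} (a C : Fin d → Matrix (Fin n) (Fin n) ℂ)
    {c : ℝ} (hc : 0 ≤ c) (ha : ∀ v, ∑ i, ‖op (a i) v‖ ^ 2 ≤ c ^ 2 * ‖v‖ ^ 2)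
    (ha' : ∀ v, ∑ i, ‖op (a i).conjTranspose v‖ ^ 2 ≤ c ^ 2 * ‖v‖ ^ 2) :
    (∑ i, (a i * C i).trace).re ≤ c * rowColumnNorm C := by
  -- The infimum argument divides by `c`; for `c = 0` the column estimate alone suffices.
  rcases hc.eq_or_lt with rfl | hc'
  · have h := re_sum_trace_mul_le_columnNorm a C le_rfl ha'
    simpa using h
  rw [← div_le_iff₀' hc']
  refine le_rowColumnNorm fun X Y hC => ?_
  rw [div_le_iff₀' hc', hC]
  simp only [Pi.add_apply, mul_add, Matrix.trace_add, Finset.sum_add_distrib, Complex.add_re]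
  exact add_le_add (re_sum_trace_mul_le_columnNorm a X hc ha')
    (re_sum_trace_mul_le_rowNorm a Y hc ha)

/-! ### Trace norm inequalities -/

theorem traceNorm_nonneg (A : Matrix (Fin n) (Fin n) ℂ) : 0 ≤ traceNorm A := trace_sqrt_nonneg _

theorem traceNorm_add_le (A B : Matrix (Fin n) (Fin n) ℂ) :
    traceNorm (A + B) ≤ traceNorm A + traceNorm B := by
  simp_rw [← columnNorm_fin_one]
  exact columnNorm_add_le _ _

theorem traceNorm_smul_le (A : Matrix (Fin n) (Fin n) ℂ) (t : ℝ) :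
    traceNorm ((t : ℂ) • A) ≤ |t| * traceNorm A := by
  simp_rw [← columnNorm_fin_one]
  exact columnNorm_smul_le _ _

theorem traceNorm_zero : traceNorm (0 : Matrix (Fin n) (Fin n) ℂ) = 0 := by
  simp [traceNorm]

theorem traceNorm_sum_smul_le {ι : Type*} (s : Finset ι) (t : ι → ℝ)
    (A : ι → Matrix (Fin n) (Fin n) ℂ) :
    traceNorm (∑ i ∈ s, (t i : ℂ) • A i) ≤ ∑ i ∈ s, |t i| * traceNorm (A i) := by
  classical
  induction s using Finset.induction_on with
  | empty => simp [traceNorm_zero]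
  | insert i s hi ih =>
    rw [Finset.sum_insert hi, Finset.sum_insert hi]
    linarith [traceNorm_add_le ((t i : ℂ) • A i) (∑ i ∈ s, (t i : ℂ) • A i),
      traceNorm_smul_le (A i) (t i)]

theorem norm_op_sq_le_of_conjTranspose {A : Matrix (Fin n) (Fin n) ℂ} {c : ℝ} (hc : 0 ≤ c)
    (hA : ∀ v, ‖op A.conjTranspose v‖ ^ 2 ≤ c ^ 2 * ‖v‖ ^ 2) (v : EuclideanSpace ℂ (Fin n)) :
    ‖op A v‖ ^ 2 ≤ c ^ 2 * ‖v‖ ^ 2 := by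
  have h1 : ‖op A.conjTranspose‖ ≤ c := by
    refine ContinuousLinearMap.opNorm_le_bound _ hc fun w => ?_
    refine le_of_sq_le_sq ?_ (by positivity)
    rw [mul_pow]
    exact hA w
  have h2 : ‖op A‖ ≤ c := by
    rwa [op_conjTranspose, LinearIsometryEquiv.norm_map] at h1
  rw [← mul_pow]
  gcongr
  exact (op A).le_of_opNorm_le h2 v

theorem re_trace_mul_le_traceNorm (F A : Matrix (Fin n) (Fin n) ℂ) {c : ℝ} (hc : 0 ≤ c)
    (hF : ∀ v, ‖op F v‖ ^ 2 ≤ c ^ 2 * ‖v‖ ^ 2) : (F * A).trace.re ≤ c * traceNorm A := by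
  have hF' : ∀ v, ‖op F.conjTranspose v‖ ^ 2 ≤ c ^ 2 * ‖v‖ ^ 2 :=
    norm_op_sq_le_of_conjTranspose hc (by simpa using hF)
  have h := re_sum_trace_mul_le_columnNorm (fun _ : Fin 1 => F) (fun _ => A) hc (by simpa using hF')
  rw [columnNorm_fin_one] at h
  simpa using h

theorem traceNorm_le_sum_norm (A : Matrix (Fin n) (Fin n) ℂ)
    (b : OrthonormalBasis (Fin n) ℂ (EuclideanSpace ℂ (Fin n))) :
    traceNorm A ≤ ∑ k, ‖op A (b k)‖ := by
  obtain ⟨a, ha, h⟩ := exists_re_sum_trace_mul_eq_columnNorm (fun _ : Fin 1 => A)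
  rw [← columnNorm_fin_one, ← h]
  refine (re_sum_trace_mul_le_sum a _ zero_le_one (by simpa using ha) b).trans (le_of_eq ?_)
  simp

theorem traceNorm_conjTranspose_le (A : Matrix (Fin n) (Fin n) ℂ) :
    traceNorm A.conjTranspose ≤ traceNorm A := by
  obtain ⟨a, ha, h⟩ := exists_re_sum_trace_mul_eq_columnNorm (fun _ : Fin 1 => A.conjTranspose)
  rw [← columnNorm_fin_one, ← h]
  have := re_trace_mul_le_traceNorm (a 0).conjTranspose A zero_le_one (by simpa using ha)
  rw [one_mul, Matrix.trace_mul_comm, ← A.conjTranspose_conjTranspose,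
    ← Matrix.conjTranspose_mul, Matrix.trace_conjTranspose, A.conjTranspose_conjTranspose] at this
  simpa using this

theorem traceNorm_conjTranspose (A : Matrix (Fin n) (Fin n) ℂ) :
    traceNorm A.conjTranspose = traceNorm A :=
  le_antisymm (traceNorm_conjTranspose_le A)
    (by simpa using traceNorm_conjTranspose_le A.conjTranspose)

end LinearAlgebra

/-! ### Norming functionals for the row-column norm -/

section Duality

variable {n : ℕ}

theorem trace_mul_vecMulVec_star (A : Matrix (Fin n) (Fin n) ℂ) (u v : EuclideanSpace ℂ (Fin n)) :
    (A * vecMulVec u.ofLp (star v.ofLp)).trace = inner ℂ v (op A u) := by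
  rw [Matrix.mul_vecMulVec, Matrix.trace_vecMulVec, EuclideanSpace.inner_eq_star_dotProduct]
  simp [op]

theorem columnNorm_vecMulVec_le {d : ℕ} (u : Fin d → EuclideanSpace ℂ (Fin n))
    (v : EuclideanSpace ℂ (Fin n)) :
    columnNorm (fun i => vecMulVec (u i).ofLp (star v.ofLp)) ≤ ‖v‖ * √(∑ i, ‖u i‖ ^ 2) := by
  obtain ⟨b, hb, h⟩ := exists_re_sum_trace_mul_eq_columnNorm
    (fun i => vecMulVec (u i).ofLp (star v.ofLp))
  rw [← h]
  simp_rw [trace_mul_vecMulVec_star, ← inner_op_conjTranspose_left, Complex.re_sum]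
  calc ∑ i, (inner ℂ (op (b i).conjTranspose v) (u i)).re
      ≤ ∑ i, ‖op (b i).conjTranspose v‖ * ‖u i‖ :=
        Finset.sum_le_sum fun i _ => re_inner_le_norm (𝕜 := ℂ) _ _
    _ ≤ √(∑ i, ‖op (b i).conjTranspose v‖ ^ 2) * √(∑ i, ‖u i‖ ^ 2) :=
        Real.sum_mul_le_sqrt_mul_sqrt _ _ _
    _ ≤ ‖v‖ * √(∑ i, ‖u i‖ ^ 2) := by
        gcongr
        rw [Real.sqrt_le_iff]
        exact ⟨norm_nonneg v, hb v⟩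

/-- Testing on the rank-one column `X_i = (a_i* v) v*` gives `t ≤ ‖v‖ √t` for the left-hand side
`t`. -/
theorem sum_norm_op_conjTranspose_sq_le {d : ℕ} {a : Fin d → Matrix (Fin n) (Fin n) ℂ}
    (ha : ∀ X : Fin d → Matrix (Fin n) (Fin n) ℂ, (∑ i, (a i * X i).trace).re ≤ columnNorm X)
    (v : EuclideanSpace ℂ (Fin n)) : ∑ i, ‖op (a i).conjTranspose v‖ ^ 2 ≤ ‖v‖ ^ 2 := by
  set t := ∑ i, ‖op (a i).conjTranspose v‖ ^ 2 with ht
  have h0 : 0 ≤ t := Finset.sum_nonneg fun i _ => sq_nonneg _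
  have h := (ha _).trans (columnNorm_vecMulVec_le (fun i => op (a i).conjTranspose v) v)
  simp_rw [trace_mul_vecMulVec_star, ← inner_op_conjTranspose_left, Complex.re_sum] at h
  have h2 : t ≤ ‖v‖ * √t := by
    refine le_trans (le_of_eq ?_) h
    refine Finset.sum_congr rfl fun i _ => ?_
    rw [inner_op_conjTranspose_left]
    exact (inner_self_eq_norm_sq (𝕜 := ℂ) (op (a i).conjTranspose v)).symm
  have h3 : √t * √t ≤ ‖v‖ * √t := by rwa [Real.mul_self_sqrt h0]
  rcases (Real.sqrt_nonneg t).eq_or_lt with h4 | h4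
  · have := (Real.sqrt_eq_zero h0).1 h4.symm
    rw [this]
    positivity
  · exact (Real.sqrt_le_left (norm_nonneg v)).1 (le_of_mul_le_mul_right h3 h4)

/-- For `z = x + iy` the real functional `x p + y r` equals `Re ((p - i r) z)`; this gives the
coefficients, transposed because of the trace pairing. -/
theorem exists_eq_re_sum_trace_mul {d : ℕ} (g : (Fin d → Matrix (Fin n) (Fin n) ℂ) →ₗ[ℝ] ℝ) :
    ∃ a : Fin d → Matrix (Fin n) (Fin n) ℂ, ∀ X, g X = (∑ i, (a i * X i).trace).re := by
  let e : Fin d → Fin n → Fin n → ℂ → (Fin d → Matrix (Fin n) (Fin n) ℂ) :=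
    fun i k l z => Pi.single i (Matrix.single k l z)
  refine ⟨fun i => Matrix.of fun l k => (g (e i k l 1) : ℂ) - Complex.I * g (e i k l Complex.I),
    fun X => ?_⟩
  have hX : X = ∑ i, ∑ l, ∑ k, e i k l (X i k l) := by
    ext j k' l'
    simp only [e, Finset.sum_apply, Matrix.sum_apply]
    rw [Finset.sum_eq_single j, Finset.sum_eq_single l', Finset.sum_eq_single k']
    · simp
    · intro k _ hk
      simp [hk]
    · simp
    · intro l _ hl
      simp [hl]
    · simp
    · intro i _ hi
      simp [Pi.single_eq_of_ne (Ne.symm hi)]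
    · simp
  have hg : ∀ i k l z, g (e i k l z) = z.re * g (e i k l 1) + z.im * g (e i k l Complex.I) := by
    intro i k l z
    have : e i k l z = z.re • e i k l 1 + z.im • e i k l Complex.I := by
      simp only [e, ← Pi.single_smul, ← Pi.single_add, Matrix.smul_single, ← Matrix.single_add]
      congr 2
      simp
    rw [this]
    simp
  conv_lhs => rw [hX]
  simp only [map_sum, Complex.re_sum, Matrix.trace, Matrix.diag, Matrix.mul_apply]
  refine Finset.sum_congr rfl fun i _ => Finset.sum_congr rfl fun l _ =>
    Finset.sum_congr rfl fun k _ => ?_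
  rw [hg]
  simp
  ring

/-- The norm of `S_1^n(ℓ_2^{rc})` is attained by a functional in the dual unit ball. -/
theorem exists_re_sum_trace_mul_eq_rowColumnNorm {d : ℕ} (C : Fin d → Matrix (Fin n) (Fin n) ℂ) :
    ∃ a : Fin d → Matrix (Fin n) (Fin n) ℂ,
      (∀ v, ∑ i, ‖op (a i) v‖ ^ 2 ≤ ‖v‖ ^ 2) ∧
      (∀ v, ∑ i, ‖op (a i).conjTranspose v‖ ^ 2 ≤ ‖v‖ ^ 2) ∧
      (∑ i, (a i * C i).trace).re = rowColumnNorm C := by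
  obtain ⟨g, hgC, hg⟩ : ∃ g : (Fin d → Matrix (Fin n) (Fin n) ℂ) →ₗ[ℝ] ℝ,
      g C = rowColumnNorm C ∧ ∀ X, g X ≤ rowColumnNorm X := by
    have h0 : rowColumnNorm (0 : Fin d → Matrix (Fin n) (Fin n) ℂ) = 0 := by
      have := rowColumnNorm_smul 2 two_pos (0 : Fin d → Matrix (Fin n) (Fin n) ℂ)
      rw [smul_zero] at this
      linarith
    by_cases hC : C = 0
    · subst hC
      exact ⟨0, by simp [h0], fun X => by simpa using rowColumnNorm_nonneg X⟩
    obtain ⟨g, h1, h2⟩ := exists_extension_of_le_sublinear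
      (LinearPMap.mkSpanSingleton C (rowColumnNorm C) hC) rowColumnNorm rowColumnNorm_smul
      rowColumnNorm_add_le (by
        rintro ⟨x, hx⟩
        obtain ⟨t, rfl⟩ := Submodule.mem_span_singleton.1 hx
        have : LinearPMap.mkSpanSingleton (σ := RingHom.id ℝ) C (rowColumnNorm C) hC ⟨t • C, hx⟩ =
            t * rowColumnNorm C := LinearPMap.mkSpanSingleton'_apply _ _ _ _ _
        rw [this]
        -- Only positive homogeneity is available; for `t ≤ 0` domination follows from
        -- nonnegativity.
        rcases lt_or_ge 0 t with ht | ht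
        · exact (rowColumnNorm_smul t ht C).ge
        · exact (mul_nonpos_of_nonpos_of_nonneg ht (rowColumnNorm_nonneg C)).trans
            (rowColumnNorm_nonneg _))
    refine ⟨g, ?_, h2⟩
    exact (h1 ⟨C, Submodule.mem_span_singleton_self C⟩).trans
      (LinearPMap.mkSpanSingleton_apply ℝ ℝ hC (rowColumnNorm C))
  obtain ⟨a, ha⟩ := exists_eq_re_sum_trace_mul g
  -- The trivial decompositions `X + 0` and `0 + X` bound `g` by both norms.
  have hcol : ∀ X, g X ≤ columnNorm X := fun X => (hg X).trans <| by
    simpa [rowNorm, traceNorm] using rowColumnNorm_add_le_columnNorm_add_rowNorm X 0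
  have hrow : ∀ X, g X ≤ rowNorm X := fun X => (hg X).trans <| by
    simpa [columnNorm, traceNorm] using rowColumnNorm_add_le_columnNorm_add_rowNorm 0 X
  refine ⟨a, fun v => ?_, sum_norm_op_conjTranspose_sq_le fun X => ha X ▸ hcol X, by rw [← ha, hgC]⟩
  have := sum_norm_op_conjTranspose_sq_le (a := fun i => (a i).conjTranspose) (fun X => ?_) v
  · simpa using this
  · have h := hrow fun i => (X i).conjTranspose
    rw [ha, rowNorm_eq_columnNorm] at h
    simp only [Matrix.conjTranspose_conjTranspose] at h
    refine le_trans (le_of_eq ?_) h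
    simp_rw [Complex.re_sum]
    refine Finset.sum_congr rfl fun i _ => ?_
    rw [Matrix.trace_mul_comm, ← Complex.conj_re, starRingEnd_apply,
      ← Matrix.trace_conjTranspose]
    simp [Matrix.conjTranspose_mul]

end Duality

open MeasureTheory ProbabilityTheory

/-! ### Scalar Gaussian moments up to order four -/

section Gaussian

/-- The moment is the fourth derivative at 0 of `exp (t²/2)`; differentiating `p · exp (t²/2)`
replaces `p` by `p' + t p`. -/
theorem integral_pow_four_gaussianReal : ∫ x, x ^ 4 ∂(gaussianReal 0 1) = 3 := by
  have h := iteratedDeriv_mgf_zero (X := id) (μ := gaussianReal 0 1)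
    (by simp [integrableExpSet_id_gaussianReal]) 4
  have hd : ∀ p p' : ℝ → ℝ, (∀ t, HasDerivAt p (p' t) t) →
      deriv (fun t => p t * Real.exp (t ^ 2 / 2)) =
        fun t => (p' t + t * p t) * Real.exp (t ^ 2 / 2) := by
    intro p p' hp
    ext t
    have h1 : HasDerivAt (fun t : ℝ => t ^ 2 / 2) t t := by
      simpa using (hasDerivAt_pow 2 t).div_const 2
    refine HasDerivAt.deriv (((hp t).mul h1.exp).congr_deriv ?_)
    ring
  have h0 : mgf id (gaussianReal 0 1) = fun t => (1 : ℝ) * Real.exp (t ^ 2 / 2) := by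
    rw [mgf_id_gaussianReal]
    simp
  have d1 := hd (fun _ => 1) (fun _ => 0) fun t => hasDerivAt_const t 1
  -- The polynomials keep the raw shape `p' + t * p` so that each rewrite feeds the next.
  have d2 := hd (fun t => 0 + t * 1) (fun _ => 1) fun t => by simpa using hasDerivAt_id' t
  have d3 := hd (fun t => 1 + t * (0 + t * 1)) (fun t => 2 * t) fun t => by
    simpa [← sq] using (hasDerivAt_pow 2 t).const_add 1
  have d4 := hd (fun t => 2 * t + t * (1 + t * (0 + t * 1))) (fun t => 3 + 3 * t ^ 2) fun t => by
    have := ((hasDerivAt_id t).const_mul 3).add (hasDerivAt_pow 3 t)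
    refine (this.congr_deriv ?_).congr_of_eventuallyEq (Filter.Eventually.of_forall fun s => ?_)
    · norm_num
    · simp; ring
  rw [h0, iteratedDeriv_eq_iterate] at h
  simp only [Function.iterate_succ, Function.iterate_zero, Function.comp_apply, id, d1, d2, d3,
    d4] at h
  simpa using h.symm

theorem integral_sq_gaussianReal : ∫ x, x ^ 2 ∂(gaussianReal 0 1) = 1 := by
  have h := variance_fun_id_gaussianReal (μ := 0) (v := 1)
  rw [variance_of_integral_eq_zero (by fun_prop) (by simp)] at h
  simpa using h

variable {Ω : Type*} [MeasurableSpace Ω] {P : Measure Ω} {d : ℕ}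
  {γ : Fin d → Ω → ℝ}

theorem memLp_of_hasLaw_gaussianReal {X : Ω → ℝ} (hX : HasLaw X (gaussianReal 0 1) P)
    (p : NNReal) : MemLp X p P := by
  have h := memLp_id_gaussianReal (μ := 0) (v := 1) p
  rw [← hX.map_eq, memLp_map_measure_iff (by fun_prop) hX.aemeasurable] at h
  exact h

theorem memLp_mul_of_hasLaw_gaussianReal {X Y : Ω → ℝ} (hX : HasLaw X (gaussianReal 0 1) P)
    (hY : HasLaw Y (gaussianReal 0 1) P) : MemLp (fun ω => X ω * Y ω) 2 P := by
  have : ENNReal.HolderTriple ((4 : NNReal) : ENNReal) ((4 : NNReal) : ENNReal) 2 := ⟨by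
    rw [← two_mul]
    norm_num
    rw [show (4 : ENNReal) = 2 * 2 by norm_num, ENNReal.mul_inv (by simp) (by simp), ← mul_assoc,
      ENNReal.mul_inv_cancel (by simp) (by simp), one_mul]⟩
  exact (memLp_of_hasLaw_gaussianReal hY 4).mul (memLp_of_hasLaw_gaussianReal hX 4)

theorem integrable_mul_mul_mul_gaussianReal (hlaw : ∀ i, HasLaw (γ i) (gaussianReal 0 1) P)
    (i j k l : Fin d) : Integrable (fun ω => γ i ω * γ j ω * (γ k ω * γ l ω)) P :=
  (memLp_mul_of_hasLaw_gaussianReal (hlaw i) (hlaw j)).integrable_mul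
    (memLp_mul_of_hasLaw_gaussianReal (hlaw k) (hlaw l))

theorem integral_eq_zero_of_hasLaw_gaussianReal {X : Ω → ℝ}
    (hX : HasLaw X (gaussianReal 0 1) P) : ∫ ω, X ω ∂P = 0 := by
  rw [hX.integral_eq]
  simp

theorem integral_mul_gaussianReal (hlaw : ∀ i, HasLaw (γ i) (gaussianReal 0 1) P)
    (hindep : iIndepFun γ P) (i j : Fin d) :
    ∫ ω, γ i ω * γ j ω ∂P = if i = j then 1 else 0 := by
  split_ifs with h
  · subst h
    have := (hlaw i).integral_comp (f := fun x => x ^ 2) (by fun_prop)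
    rw [integral_sq_gaussianReal] at this
    simpa [← sq] using this
  · rw [(hindep.indepFun h).integral_fun_mul_eq_mul_integral
      (hlaw i).aemeasurable.aestronglyMeasurable (hlaw j).aemeasurable.aestronglyMeasurable,
      integral_eq_zero_of_hasLaw_gaussianReal (hlaw i), zero_mul]

/-- An index occurring only once gives a centred factor independent of the rest. -/
theorem integral_mul_eq_zero_of_ne (hlaw : ∀ i, HasLaw (γ i) (gaussianReal 0 1) P)
    (hindep : iIndepFun γ P) {i j k l : Fin d} (hj : i ≠ j) (hk : i ≠ k) (hl : i ≠ l) :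
    ∫ ω, γ i ω * γ j ω * (γ k ω * γ l ω) ∂P = 0 := by
  have hm := fun i => (hlaw i).aemeasurable
  have h : IndepFun (γ i) (fun ω => γ j ω * (γ k ω * γ l ω)) P :=
    (hindep.indepFun_finset₀ {i} {j, k, l} (by simp [hj, hk, hl]) hm).comp
      (φ := fun x : ({i} : Finset (Fin d)) → ℝ => x ⟨i, by simp⟩)
      (ψ := fun x : ({j, k, l} : Finset (Fin d)) → ℝ =>
        x ⟨j, by simp⟩ * (x ⟨k, by simp⟩ * x ⟨l, by simp⟩))
      (by fun_prop) (by fun_prop)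
  have h2 := h.integral_fun_mul_eq_mul_integral (hm i).aestronglyMeasurable
    ((hm j).mul ((hm k).mul (hm l))).aestronglyMeasurable
  rw [integral_eq_zero_of_hasLaw_gaussianReal (hlaw i), zero_mul] at h2
  simpa only [mul_assoc] using h2

theorem integral_sq_mul_of_ne (hlaw : ∀ i, HasLaw (γ i) (gaussianReal 0 1) P)
    (hindep : iIndepFun γ P) {i k l : Fin d} (hk : i ≠ k) (hl : i ≠ l) :
    ∫ ω, γ i ω * γ i ω * (γ k ω * γ l ω) ∂P = if k = l then 1 else 0 := by
  have hm := fun i => (hlaw i).aemeasurable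
  have h : IndepFun (fun ω => γ i ω * γ i ω) (fun ω => γ k ω * γ l ω) P :=
    (hindep.indepFun_finset₀ {i} {k, l} (by simp [hk, hl]) hm).comp
      (φ := fun x : ({i} : Finset (Fin d)) → ℝ => x ⟨i, by simp⟩ * x ⟨i, by simp⟩)
      (ψ := fun x : ({k, l} : Finset (Fin d)) → ℝ => x ⟨k, by simp⟩ * x ⟨l, by simp⟩)
      (by fun_prop) (by fun_prop)
  rw [h.integral_fun_mul_eq_mul_integral ((hm i).mul (hm i)).aestronglyMeasurable
    ((hm k).mul (hm l)).aestronglyMeasurable, integral_mul_gaussianReal hlaw hindep,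
    integral_mul_gaussianReal hlaw hindep, if_pos rfl, one_mul]

/-- Wick's formula for fourth moments of independent standard Gaussian variables. -/
theorem integral_mul_mul_mul_gaussianReal (hlaw : ∀ i, HasLaw (γ i) (gaussianReal 0 1) P)
    (hindep : iIndepFun γ P) (i j k l : Fin d) :
    ∫ ω, γ i ω * γ j ω * (γ k ω * γ l ω) ∂P =
      (if i = j ∧ k = l then 1 else 0) + (if i = k ∧ j = l then 1 else 0) +
        (if i = l ∧ j = k then 1 else 0) := by
  have hA : ∀ {i j k l : Fin d}, i ≠ j → i ≠ k → i ≠ l →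
    ∫ ω, γ i ω * γ j ω * (γ k ω * γ l ω) ∂P = 0 := integral_mul_eq_zero_of_ne hlaw hindep
  have hB : ∀ {i k l : Fin d}, i ≠ k → i ≠ l →
    ∫ ω, γ i ω * γ i ω * (γ k ω * γ l ω) ∂P = if k = l then 1 else 0 :=
    integral_sq_mul_of_ne hlaw hindep
  have hC : ∀ i, ∫ ω, γ i ω * γ i ω * (γ i ω * γ i ω) ∂P = 3 := by
    intro i
    have := (hlaw i).integral_comp (f := fun x => x ^ 4) (by fun_prop)
    rw [integral_pow_four_gaussianReal] at this
    rw [← this]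
    refine integral_congr_ae (Filter.Eventually.of_forall fun ω => ?_)
    simp only [Function.comp_apply]
    ring
  have hs1 : ∀ i j k l, ∫ ω, γ i ω * γ j ω * (γ k ω * γ l ω) ∂P =
      ∫ ω, γ i ω * γ k ω * (γ j ω * γ l ω) ∂P := fun i j k l => by congr 1; ext; ring
  have hs2 : ∀ i j k l, ∫ ω, γ i ω * γ j ω * (γ k ω * γ l ω) ∂P =
      ∫ ω, γ i ω * γ l ω * (γ j ω * γ k ω) ∂P := fun i j k l => by congr 1; ext; ring
  have hs3 : ∀ i j k l, ∫ ω, γ i ω * γ j ω * (γ k ω * γ l ω) ∂P =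
      ∫ ω, γ k ω * γ l ω * (γ i ω * γ j ω) ∂P := fun i j k l => by congr 1; ext; ring
  have hs4 : ∀ i j k l, ∫ ω, γ i ω * γ j ω * (γ k ω * γ l ω) ∂P =
      ∫ ω, γ l ω * γ i ω * (γ j ω * γ k ω) ∂P := fun i j k l => by congr 1; ext; ring
  -- Split by which of `j`, `k`, `l` equal `i`, then permute the factors to isolate a single index
  -- (`hA`) or a pair (`hB`).
  by_cases hij : i = j
  · subst hij
    by_cases hik : i = k
    · subst hik
      by_cases hil : i = l
      · subst hil
        rw [hC]; norm_num
      · rw [hs4, hA (Ne.symm hil) (Ne.symm hil) (Ne.symm hil)]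
        simp [hil]
    · by_cases hil : i = l
      · subst hil
        rw [hs3, hA (Ne.symm hik) (Ne.symm hik) (Ne.symm hik)]
        simp [hik, Ne.symm hik]
      · rw [hB hik hil]
        simp [hik, hil]
  · by_cases hik : i = k
    · subst hik
      by_cases hil : i = l
      · subst hil
        rw [show (∫ ω, γ i ω * γ j ω * (γ i ω * γ i ω) ∂P) =
          ∫ ω, γ j ω * γ i ω * (γ i ω * γ i ω) ∂P by congr 1; ext; ring,
          hA (Ne.symm hij) (Ne.symm hij) (Ne.symm hij)]
        simp [hij, Ne.symm hij]
      · rw [hs1, hB hij hil]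
        simp [hij, hil]
    · by_cases hil : i = l
      · subst hil
        rw [hs2, hB hij hik]
        simp [hij, hik]
      · rw [hA hij hik hil]
        simp [hij, hik, hil]

end Gaussian

/-! ### Gaussian sums with vector coefficients -/

section Gaussian

variable {Ω : Type*} [MeasurableSpace Ω] {P : Measure Ω} {d : ℕ} {γ : Fin d → Ω → ℝ}
  {V : Type*} [NormedAddCommGroup V] [InnerProductSpace ℂ V]

theorem memLp_two_of_hasLaw_gaussianReal {X : Ω → ℝ} (hX : HasLaw X (gaussianReal 0 1) P) :
    MemLp X 2 P := by
  simpa using memLp_of_hasLaw_gaussianReal hX 2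

theorem memLp_two_sum_smul (hlaw : ∀ i, HasLaw (γ i) (gaussianReal 0 1) P) (u : Fin d → V) :
    MemLp (fun ω => ∑ i, (γ i ω : ℂ) • u i) 2 P :=
  memLp_finsetSum _ fun i _ => (ContinuousLinearMap.toSpanSingleton ℂ (u i)).comp_memLp'
    (memLp_two_of_hasLaw_gaussianReal (hlaw i)).ofReal

theorem norm_sum_smul_sq {ι : Type*} [Fintype ι] (t : ι → ℝ) (u : ι → V) :
    ‖∑ i, (t i : ℂ) • u i‖ ^ 2 = ∑ i, ∑ j, t i * t j * (inner ℂ (u i) (u j)).re := by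
  rw [← inner_self_eq_norm_sq (𝕜 := ℂ)]
  simp_rw [sum_inner, inner_sum, inner_smul_left, inner_smul_right]
  simp [mul_assoc]

theorem integrable_norm_sum_smul_sq (hlaw : ∀ i, HasLaw (γ i) (gaussianReal 0 1) P)
    (u : Fin d → V) : Integrable (fun ω => ‖∑ i, (γ i ω : ℂ) • u i‖ ^ 2) P := by
  simp_rw [norm_sum_smul_sq]
  exact integrable_finsetSum _ fun i _ => integrable_finsetSum _ fun j _ =>
    ((memLp_two_of_hasLaw_gaussianReal (hlaw i)).integrable_mul
      (memLp_two_of_hasLaw_gaussianReal (hlaw j))).mul_const _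

theorem integral_norm_sum_smul_sq (hlaw : ∀ i, HasLaw (γ i) (gaussianReal 0 1) P)
    (hindep : iIndepFun γ P) (u : Fin d → V) :
    ∫ ω, ‖∑ i, (γ i ω : ℂ) • u i‖ ^ 2 ∂P = ∑ i, ‖u i‖ ^ 2 := by
  have hint : ∀ i j, Integrable (fun ω => γ i ω * γ j ω * (inner ℂ (u i) (u j)).re) P :=
    fun i j => ((memLp_two_of_hasLaw_gaussianReal (hlaw i)).integrable_mul
      (memLp_two_of_hasLaw_gaussianReal (hlaw j))).mul_const _
  simp_rw [norm_sum_smul_sq]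
  rw [integral_finsetSum _ fun i _ => integrable_finsetSum _ fun j _ => hint i j]
  refine Finset.sum_congr rfl fun i _ => ?_
  rw [integral_finsetSum _ fun j _ => hint i j]
  simp_rw [integral_mul_const, integral_mul_gaussianReal hlaw hindep]
  simp only [ite_mul, one_mul, zero_mul, Finset.sum_ite_eq, Finset.mem_univ, if_true]
  exact inner_self_eq_norm_sq (𝕜 := ℂ) (u i)

theorem integrable_norm_sum_mul_smul_sq (hlaw : ∀ i, HasLaw (γ i) (gaussianReal 0 1) P)
    (u : Fin d → Fin d → V) :
    Integrable (fun ω => ‖∑ i, ∑ j, ((γ i ω * γ j ω : ℝ) : ℂ) • u i j‖ ^ 2) P := by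
  simp_rw [← Fintype.sum_prod_type' (f := fun i j => ((γ i _ * γ j _ : ℝ) : ℂ) • u i j)]
  simp_rw [norm_sum_smul_sq (fun x : Fin d × Fin d => γ x.1 _ * γ x.2 _) fun x => u x.1 x.2]
  exact integrable_finsetSum _ fun i _ => integrable_finsetSum _ fun j _ =>
    (integrable_mul_mul_mul_gaussianReal hlaw _ _ _ _).mul_const _

/-- Of the three Wick pairings, one gives the diagonal square and one gives `∑ ‖u i j‖²`; the
crossed one, `∑ Re ⟪u i j, u j i⟫`, is at most the latter. -/
theorem integral_norm_sum_mul_smul_sq_le (hlaw : ∀ i, HasLaw (γ i) (gaussianReal 0 1) P)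
    (hindep : iIndepFun γ P) (u : Fin d → Fin d → V) :
    ∫ ω, ‖∑ i, ∑ j, ((γ i ω * γ j ω : ℝ) : ℂ) • u i j‖ ^ 2 ∂P ≤
      ‖∑ i, u i i‖ ^ 2 + 2 * ∑ i, ∑ j, ‖u i j‖ ^ 2 := by
  have hint : ∀ i j k l, Integrable
      (fun ω => γ i ω * γ j ω * (γ k ω * γ l ω) * (inner ℂ (u i j) (u k l)).re) P :=
    fun i j k l => (integrable_mul_mul_mul_gaussianReal hlaw _ _ _ _).mul_const _
  have h1 : ∫ ω, ‖∑ i, ∑ j, ((γ i ω * γ j ω : ℝ) : ℂ) • u i j‖ ^ 2 ∂P =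
      ∑ i, ∑ j, ∑ k, ∑ l, ((if i = j ∧ k = l then 1 else 0) + (if i = k ∧ j = l then 1 else 0) +
        (if i = l ∧ j = k then 1 else 0)) * (inner ℂ (u i j) (u k l)).re := by
    simp_rw [← Fintype.sum_prod_type' (f := fun i j => ((γ i _ * γ j _ : ℝ) : ℂ) • u i j)]
    simp_rw [norm_sum_smul_sq (fun x : Fin d × Fin d => γ x.1 _ * γ x.2 _) fun x => u x.1 x.2]
    rw [integral_finsetSum _ fun x _ => integrable_finsetSum _ fun y _ => hint _ _ _ _,
      Fintype.sum_prod_type]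
    refine Finset.sum_congr rfl fun i _ => Finset.sum_congr rfl fun j _ => ?_
    rw [integral_finsetSum _ fun y _ => hint _ _ _ _, Fintype.sum_prod_type]
    refine Finset.sum_congr rfl fun k _ => Finset.sum_congr rfl fun l _ => ?_
    rw [integral_mul_const, integral_mul_mul_mul_gaussianReal hlaw hindep]
  have h2 : ‖∑ i, u i i‖ ^ 2 = ∑ i, ∑ j, ∑ k, ∑ l,
      (if i = j ∧ k = l then 1 else 0) * (inner ℂ (u i j) (u k l)).re := by
    have := norm_sum_smul_sq (fun _ => 1) fun i => u i i
    simp only [Complex.ofReal_one, one_smul, one_mul] at this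
    rw [this]
    simp [ite_and]
  have h3 : ∑ i, ∑ j, ‖u i j‖ ^ 2 = ∑ i, ∑ j, ∑ k, ∑ l,
      (if i = k ∧ j = l then 1 else 0) * (inner ℂ (u i j) (u k l)).re := by
    simp only [ite_and, ite_mul, one_mul, zero_mul, Finset.sum_ite_eq, Finset.mem_univ, if_true,
      Finset.sum_ite_irrel, Finset.sum_const_zero]
    exact Finset.sum_congr rfl fun i _ => Finset.sum_congr rfl fun j _ =>
      (inner_self_eq_norm_sq (𝕜 := ℂ) (u i j)).symm
  have h4 : ∑ i, ∑ j, ∑ k, ∑ l, (if i = l ∧ j = k then 1 else 0) * (inner ℂ (u i j) (u k l)).re ≤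
      ∑ i, ∑ j, ‖u i j‖ ^ 2 := by
    have : ∑ i, ∑ j, ∑ k, ∑ l, (if i = l ∧ j = k then 1 else 0) * (inner ℂ (u i j) (u k l)).re =
        ∑ i, ∑ j, (inner ℂ (u i j) (u j i)).re := by
      simp [ite_and]
    rw [this]
    have h5 : ∑ i, ∑ j, (inner ℂ (u i j) (u j i)).re ≤
        ∑ i, ∑ j, (‖u i j‖ ^ 2 + ‖u j i‖ ^ 2) / 2 := by
      refine Finset.sum_le_sum fun i _ => Finset.sum_le_sum fun j _ => ?_
      have := re_inner_le_norm (𝕜 := ℂ) (u i j) (u j i)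
      simp only [RCLike.re_to_complex] at this
      nlinarith [sq_nonneg (‖u i j‖ - ‖u j i‖)]
    refine h5.trans (le_of_eq ?_)
    simp_rw [← Finset.sum_div, Finset.sum_add_distrib]
    rw [Finset.sum_comm (f := fun i j => ‖u j i‖ ^ 2)]
    ring
  rw [h1]
  simp only [add_mul, Finset.sum_add_distrib]
  linarith

/-- Bessel's inequality for independent standard Gaussian variables. -/
theorem sum_norm_integral_smul_sq_le [CompleteSpace V]
    (hlaw : ∀ i, HasLaw (γ i) (gaussianReal 0 1) P) (hindep : iIndepFun γ P) {Z : Ω → V}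
    (hZ : MemLp Z 2 P) : ∑ i, ‖∫ ω, (γ i ω : ℂ) • Z ω ∂P‖ ^ 2 ≤ ∫ ω, ‖Z ω‖ ^ 2 ∂P := by
  set b : Fin d → V := fun i => ∫ ω, (γ i ω : ℂ) • Z ω ∂P with hb
  have hγ : ∀ i, MemLp (fun ω => (γ i ω : ℂ)) 2 P := fun i =>
    (memLp_two_of_hasLaw_gaussianReal (hlaw i)).ofReal
  have hi1 : ∀ i, Integrable (fun ω => (γ i ω : ℂ) • Z ω) P := fun i =>
    memLp_one_iff_integrable.1 (hZ.smul (hγ i))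
  have hi2 : ∀ i, Integrable (fun ω => (inner ℂ (b i) ((γ i ω : ℂ) • Z ω)).re) P := fun i =>
    ((hi1 i).const_inner (𝕜 := ℂ) (b i)).re
  have hi3 : Integrable (fun ω => ‖Z ω‖ ^ 2) P := hZ.integrable_norm_pow (by norm_num)
  have hexp : ∀ ω, ‖Z ω - ∑ i, (γ i ω : ℂ) • b i‖ ^ 2 = ‖Z ω‖ ^ 2 -
      2 * (∑ i, (inner ℂ (b i) ((γ i ω : ℂ) • Z ω)).re) + ‖∑ i, (γ i ω : ℂ) • b i‖ ^ 2 := by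
    intro ω
    rw [norm_sub_sq (𝕜 := ℂ), inner_re_symm, sum_inner]
    simp
  have hint : ∀ i, ∫ ω, (inner ℂ (b i) ((γ i ω : ℂ) • Z ω)).re ∂P = ‖b i‖ ^ 2 := by
    intro i
    have h1 := integral_re ((hi1 i).const_inner (𝕜 := ℂ) (b i))
    have h2 := integral_inner (𝕜 := ℂ) (hi1 i) (b i)
    simp only [RCLike.re_to_complex] at h1
    rw [h1, h2]
    exact inner_self_eq_norm_sq (𝕜 := ℂ) (b i)
  -- The mean squared distance from `Z` to its projection `∑ γ_i b_i` expands to `E‖Z‖² - ∑ ‖b_i‖²`.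
  have h0 : 0 ≤ ∫ ω, ‖Z ω - ∑ i, (γ i ω : ℂ) • b i‖ ^ 2 ∂P :=
    integral_nonneg fun ω => sq_nonneg _
  have hi4 : Integrable (fun ω => 2 * ∑ i, (inner ℂ (b i) ((γ i ω : ℂ) • Z ω)).re) P :=
    (integrable_finsetSum _ fun i _ => hi2 i).const_mul 2
  have hi5 : Integrable (fun ω => ‖Z ω‖ ^ 2 -
      2 * ∑ i, (inner ℂ (b i) ((γ i ω : ℂ) • Z ω)).re) P := hi3.sub hi4
  simp_rw [hexp] at h0
  rw [integral_add hi5 (integrable_norm_sum_smul_sq hlaw b), integral_sub hi3 hi4,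
    integral_const_mul, integral_finsetSum _ fun i _ => hi2 i,
    integral_norm_sum_smul_sq hlaw hindep] at h0
  simp_rw [hint] at h0
  linarith

end Gaussian

/-! ### Smooth truncation of a matrix -/

section Truncation

variable {n : ℕ}

/-- The smooth truncation `3 S (3 + S* S)⁻¹` of a matrix, of operator norm at most `√3 / 2`. -/
noncomputable def Matrix.smoothTruncation (S : Matrix (Fin n) (Fin n) ℂ) :
    Matrix (Fin n) (Fin n) ℂ :=
  (3 : ℂ) • (S * ((3 : ℂ) • 1 + S.conjTranspose * S)⁻¹)

theorem isUnit_det_three_add (S : Matrix (Fin n) (Fin n) ℂ) :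
    IsUnit ((3 : ℂ) • 1 + S.conjTranspose * S).det := by
  have h : ((3 : ℂ) • 1 + S.conjTranspose * S).PosDef :=
    (Matrix.PosDef.one.smul (by norm_num)).add_posSemidef
      (Matrix.posSemidef_conjTranspose_mul_self S)
  exact (Matrix.isUnit_iff_isUnit_det _).1 h.isUnit

/-- Follows from the intertwining `(3 + S*S) S* = S* (3 + SS*)`. It lets adjoint estimates be read
off from direct ones. -/
theorem smoothTruncation_conjTranspose (S : Matrix (Fin n) (Fin n) ℂ) :
    S.conjTranspose.smoothTruncation = S.smoothTruncation.conjTranspose := by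
  have h1 := isUnit_det_three_add S
  have h2 := isUnit_det_three_add S.conjTranspose
  rw [smoothTruncation, smoothTruncation, Matrix.conjTranspose_smul, Matrix.conjTranspose_mul,
    Matrix.conjTranspose_nonsing_inv]
  have h3 : ((3 : ℂ) • 1 + S.conjTranspose * S).conjTranspose =
      (3 : ℂ) • 1 + S.conjTranspose * S := by
    simp [Matrix.conjTranspose_add, Matrix.conjTranspose_smul]
  rw [h3]
  congr 1
  · simp
  rw [Matrix.conjTranspose_conjTranspose] at *
  set D := (3 : ℂ) • 1 + S.conjTranspose * S
  set D' := (3 : ℂ) • 1 + S * S.conjTranspose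
  have h : D * S.conjTranspose = S.conjTranspose * D' := by
    simp only [D, D', add_mul, mul_add, mul_assoc]
    simp
  calc S.conjTranspose * D'⁻¹ = D⁻¹ * (D * S.conjTranspose) * D'⁻¹ := by
        rw [← mul_assoc, Matrix.nonsing_inv_mul _ h1, one_mul]
    _ = D⁻¹ * S.conjTranspose := by
        rw [h, mul_assoc, mul_assoc, Matrix.mul_nonsing_inv _ h2, mul_one]

/-- `4 Re ⟪x, y⟫ ≤ ‖x + y‖²` with `x = 3w` and `y = S*S w`. -/
theorem twelve_mul_norm_op_sq_le (S : Matrix (Fin n) (Fin n) ℂ) (w : EuclideanSpace ℂ (Fin n)) :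
    12 * ‖op S w‖ ^ 2 ≤ ‖(3 : ℂ) • w + op (S.conjTranspose * S) w‖ ^ 2 := by
  have hin : (inner ℂ w (op (S.conjTranspose * S) w)).re = ‖op S w‖ ^ 2 := by
    rw [← norm_op_sq, Complex.ofReal_re]
  have h1 := norm_add_sq (𝕜 := ℂ) ((3 : ℂ) • w) (op (S.conjTranspose * S) w)
  have h2 := norm_sub_sq (𝕜 := ℂ) ((3 : ℂ) • w) (op (S.conjTranspose * S) w)
  have h3 : RCLike.re (inner ℂ ((3 : ℂ) • w) (op (S.conjTranspose * S) w)) =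
      3 * ‖op S w‖ ^ 2 := by
    rw [inner_smul_left, ← hin]
    simp
  rw [h3] at h1 h2
  nlinarith [sq_nonneg ‖(3 : ℂ) • w - op (S.conjTranspose * S) w‖]

/-- Substituting `v = (3 + S*S) w` removes the inverse from both bounds below. -/
theorem exists_eq_three_smul_add (S : Matrix (Fin n) (Fin n) ℂ) (v : EuclideanSpace ℂ (Fin n)) :
    ∃ w, v = (3 : ℂ) • w + op (S.conjTranspose * S) w ∧
      op S.smoothTruncation v = (3 : ℂ) • op S w := by
  refine ⟨op ((3 : ℂ) • 1 + S.conjTranspose * S)⁻¹ v, ?_, ?_⟩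
  · have h : op (((3 : ℂ) • 1 + S.conjTranspose * S) * ((3 : ℂ) • 1 + S.conjTranspose * S)⁻¹) v =
        v := by
      rw [Matrix.mul_nonsing_inv _ (isUnit_det_three_add S)]
      simp [op]
    conv_lhs => rw [← h, op_mul_apply]
    simp [op]
  · rw [smoothTruncation, ← op_mul_apply]
    simp [op]

theorem norm_op_smoothTruncation_sq_le (S : Matrix (Fin n) (Fin n) ℂ)
    (v : EuclideanSpace ℂ (Fin n)) :
    ‖op S.smoothTruncation v‖ ^ 2 ≤ (√3 / 2) ^ 2 * ‖v‖ ^ 2 := by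
  obtain ⟨w, hv, h⟩ := exists_eq_three_smul_add S v
  rw [h, norm_smul, mul_pow, div_pow, Real.sq_sqrt (by norm_num)]
  have := twelve_mul_norm_op_sq_le S w
  rw [← hv] at this
  norm_num
  linarith

theorem norm_op_sub_smoothTruncation_sq_le (S : Matrix (Fin n) (Fin n) ℂ)
    (v : EuclideanSpace ℂ (Fin n)) :
    ‖op (S - S.smoothTruncation) v‖ ^ 2 ≤ ‖op (S.conjTranspose * S) v‖ ^ 2 / 12 := by
  obtain ⟨w, hv, h⟩ := exists_eq_three_smul_add S v
  have h1 : op (S - S.smoothTruncation) v = op S (op (S.conjTranspose * S) w) := by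
    rw [op, map_sub, _root_.sub_apply, h, hv, map_add, map_smul, add_sub_cancel_left]
  -- The remainder is `S (S*S w)`, and `3 + S*S` sends `S*S w` to `S*S v`.
  have := twelve_mul_norm_op_sq_le S (op (S.conjTranspose * S) w)
  rw [← map_smul, ← map_add, ← hv] at this
  rw [h1]
  linarith

theorem continuous_smoothTruncation :
    Continuous (smoothTruncation : Matrix (Fin n) (Fin n) ℂ → Matrix (Fin n) (Fin n) ℂ) := by
  unfold smoothTruncation
  have h : Continuous fun S : Matrix (Fin n) (Fin n) ℂ =>
      ((3 : ℂ) • (1 : Matrix (Fin n) (Fin n) ℂ) + S.conjTranspose * S)⁻¹ := by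
    simp_rw [Matrix.inv_def, Ring.inverse_eq_inv']
    have hc : Continuous fun S : Matrix (Fin n) (Fin n) ℂ =>
        ((3 : ℂ) • (1 : Matrix (Fin n) (Fin n) ℂ) + S.conjTranspose * S) :=
      continuous_const.add (continuous_id.matrix_conjTranspose.matrix_mul continuous_id)
    exact (hc.matrix_det.inv₀ fun S => (isUnit_det_three_add S).ne_zero).smul hc.matrix_adjugate
  exact (continuous_id.matrix_mul h).const_smul (3 : ℂ)

theorem norm_apply_le_of_norm_op_sq_le {A : Matrix (Fin n) (Fin n) ℂ} {c : ℝ} (hc : 0 ≤ c)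
    (hA : ∀ v, ‖op A v‖ ^ 2 ≤ c ^ 2 * ‖v‖ ^ 2) (k l : Fin n) : ‖A k l‖ ≤ c := by
  have h := hA (EuclideanSpace.single l 1)
  have h2 : op A (EuclideanSpace.single l 1) k = A k l := by
    simp [op]
  rw [PiLp.norm_single, norm_one, one_pow, mul_one] at h
  rw [← h2]
  exact (PiLp.norm_apply_le _ k).trans (le_of_sq_le_sq h hc)

end Truncation

/-! ### Expectations of random matrices -/

section EntrywiseMean

variable {n : ℕ} {Ω : Type*} [MeasurableSpace Ω] (P : Measure Ω)

/-- The entrywise expectation of a random matrix. -/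
noncomputable def entrywiseMean (M : Ω → Matrix (Fin n) (Fin n) ℂ) : Matrix (Fin n) (Fin n) ℂ :=
  Matrix.of fun k l => ∫ ω, M ω k l ∂P

variable {P} {M : Ω → Matrix (Fin n) (Fin n) ℂ}

theorem conjTranspose_entrywiseMean (M : Ω → Matrix (Fin n) (Fin n) ℂ) :
    (entrywiseMean P M).conjTranspose = entrywiseMean P fun ω => (M ω).conjTranspose := by
  ext k l
  simp only [entrywiseMean, Matrix.conjTranspose_apply, Matrix.of_apply]
  exact integral_conj.symm

theorem trace_entrywiseMean_mul (hM : ∀ k l, Integrable (fun ω => M ω k l) P)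
    (A : Matrix (Fin n) (Fin n) ℂ) :
    (entrywiseMean P M * A).trace = ∫ ω, (M ω * A).trace ∂P := by
  simp only [Matrix.trace, Matrix.diag, Matrix.mul_apply, entrywiseMean, Matrix.of_apply]
  rw [integral_finsetSum _ fun k _ => integrable_finsetSum _ fun l _ => (hM k l).mul_const _]
  refine Finset.sum_congr rfl fun k _ => ?_
  rw [integral_finsetSum _ fun l _ => (hM k l).mul_const _]
  simp_rw [integral_mul_const]

theorem integrable_trace_mul (hM : ∀ k l, Integrable (fun ω => M ω k l) P)
    (A : Matrix (Fin n) (Fin n) ℂ) : Integrable (fun ω => (M ω * A).trace) P := by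
  simp only [Matrix.trace, Matrix.diag, Matrix.mul_apply]
  exact integrable_finsetSum _ fun k _ => integrable_finsetSum _ fun l _ => (hM k l).mul_const _

theorem op_apply_eq_sum_single (A : Matrix (Fin n) (Fin n) ℂ) (v : EuclideanSpace ℂ (Fin n)) :
    op A v = ∑ k, ∑ l, (A k l) • (v l • EuclideanSpace.single k (1 : ℂ)) := by
  ext j
  simp [op, Matrix.mulVec, dotProduct, Finset.sum_apply, Pi.single_apply]

theorem memLp_op_apply {p : ENNReal} (hM : ∀ k l, MemLp (fun ω => M ω k l) p P)
    (v : EuclideanSpace ℂ (Fin n)) : MemLp (fun ω => op (M ω) v) p P := by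
  simp_rw [op_apply_eq_sum_single]
  exact memLp_finsetSum _ fun k _ => memLp_finsetSum _ fun l _ =>
    (ContinuousLinearMap.toSpanSingleton ℂ _).comp_memLp' (hM k l)

theorem op_entrywiseMean (hM : ∀ k l, Integrable (fun ω => M ω k l) P)
    (v : EuclideanSpace ℂ (Fin n)) : op (entrywiseMean P M) v = ∫ ω, op (M ω) v ∂P := by
  simp_rw [op_apply_eq_sum_single]
  rw [integral_finsetSum _ fun k _ => integrable_finsetSum _ fun l _ => (hM k l).smul_const _]
  refine Finset.sum_congr rfl fun k _ => ?_
  rw [integral_finsetSum _ fun l _ => (hM k l).smul_const _]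
  simp_rw [integral_smul_const]
  rfl

end EntrywiseMean

/-! ### Integrability and the upper bound -/

section Khintchine

variable {Ω : Type*} [MeasurableSpace Ω] {P : Measure Ω} {n d : ℕ} {γ : Fin d → Ω → ℝ}

/-- Supplies measurability of the random trace norm. -/
theorem continuous_traceNorm_sum_smul (C : Fin d → Matrix (Fin n) (Fin n) ℂ) :
    Continuous fun t : Fin d → ℝ => traceNorm (∑ i, (t i : ℂ) • C i) := by
  refine (LipschitzWith.of_le_add_mul (Real.toNNReal (∑ i, traceNorm (C i)))
    fun s t => ?_).continuous
  have h1 : ∑ i, (s i : ℂ) • C i = ∑ i, (t i : ℂ) • C i + ∑ i, ((s i - t i : ℝ) : ℂ) • C i := by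
    rw [← Finset.sum_add_distrib]
    refine Finset.sum_congr rfl fun i _ => ?_
    rw [← add_smul]
    congr 1
    push_cast
    ring
  rw [h1, Real.coe_toNNReal _ (Finset.sum_nonneg fun i _ => traceNorm_nonneg _), Finset.sum_mul]
  refine (traceNorm_add_le _ _).trans (add_le_add_right ((traceNorm_sum_smul_le _ _ _).trans ?_) _)
  refine Finset.sum_le_sum fun i _ => ?_
  rw [mul_comm]
  exact mul_le_mul_of_nonneg_left (dist_le_pi_dist s t i) (traceNorm_nonneg _)

theorem integrable_traceNorm_sum_smul (hlaw : ∀ i, HasLaw (γ i) (gaussianReal 0 1) P)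
    (C : Fin d → Matrix (Fin n) (Fin n) ℂ) :
    Integrable (fun ω => traceNorm (∑ i, (γ i ω : ℂ) • C i)) P := by
  have hm : AEMeasurable (fun ω i => γ i ω) P :=
    aemeasurable_pi_lambda _ fun i => (hlaw i).aemeasurable
  have h1 : Integrable (fun ω => ∑ i, |γ i ω| * traceNorm (C i)) P := by
    refine integrable_finsetSum _ fun i _ => Integrable.mul_const ?_ _
    exact (memLp_one_iff_integrable.1
      (by simpa using memLp_of_hasLaw_gaussianReal (hlaw i) 1)).abs
  refine h1.mono' ((continuous_traceNorm_sum_smul C).measurable.comp_aemeasurable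
    hm).aestronglyMeasurable (Filter.Eventually.of_forall fun ω => ?_)
  rw [Real.norm_of_nonneg (traceNorm_nonneg _)]
  exact traceNorm_sum_smul_le _ _ _

theorem op_sum_smul_apply (t : Fin d → ℝ) (X : Fin d → Matrix (Fin n) (Fin n) ℂ)
    (v : EuclideanSpace ℂ (Fin n)) :
    op (∑ i, (t i : ℂ) • X i) v = ∑ i, (t i : ℂ) • op (X i) v := by
  simp only [op, map_sum, map_smul, _root_.sum_apply, _root_.smul_apply]

theorem conjTranspose_sum_smul (t : Fin d → ℝ) (X : Fin d → Matrix (Fin n) (Fin n) ℂ) :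
    (∑ i, (t i : ℂ) • X i).conjTranspose = ∑ i, (t i : ℂ) • (X i).conjTranspose := by
  rw [Matrix.conjTranspose_sum]
  refine Finset.sum_congr rfl fun i _ => ?_
  rw [Matrix.conjTranspose_smul]
  simp

theorem integral_traceNorm_le_columnNorm [IsProbabilityMeasure P]
    (hlaw : ∀ i, HasLaw (γ i) (gaussianReal 0 1) P) (hindep : iIndepFun γ P)
    (X : Fin d → Matrix (Fin n) (Fin n) ℂ) :
    ∫ ω, traceNorm (∑ i, (γ i ω : ℂ) • X i) ∂P ≤ columnNorm X := by
  obtain ⟨b, q, h0, -, h2, h3⟩ := exists_orthonormalBasis_columnNorm X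
  have hLp : ∀ k, MemLp (fun ω => ‖∑ i, (γ i ω : ℂ) • op (X i) (b k)‖) 2 P :=
    fun k => (memLp_two_sum_smul hlaw _).norm
  have hint : ∀ k, Integrable (fun ω => ‖∑ i, (γ i ω : ℂ) • op (X i) (b k)‖) P :=
    fun k => (hLp k).integrable (by norm_num)
  calc ∫ ω, traceNorm (∑ i, (γ i ω : ℂ) • X i) ∂P
      ≤ ∫ ω, ∑ k, ‖∑ i, (γ i ω : ℂ) • op (X i) (b k)‖ ∂P := by
        refine integral_mono (integrable_traceNorm_sum_smul hlaw X)
          (integrable_finsetSum _ fun k _ => hint k) fun ω => ?_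
        refine (traceNorm_le_sum_norm _ b).trans (le_of_eq ?_)
        simp_rw [op_sum_smul_apply]
    _ = ∑ k, ∫ ω, ‖∑ i, (γ i ω : ℂ) • op (X i) (b k)‖ ∂P :=
        integral_finsetSum _ fun k _ => hint k
    _ ≤ ∑ k, q k := by
        refine Finset.sum_le_sum fun k _ => le_of_sq_le_sq ?_ (h0 k)
        rw [← h2, ← integral_norm_sum_smul_sq hlaw hindep]
        -- Jensen's inequality `(E f)² ≤ E f²`, as nonnegativity of the variance.
        have hv := variance_nonneg (fun ω => ‖∑ i, (γ i ω : ℂ) • op (X i) (b k)‖) P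
        rw [variance_eq_sub (hLp k)] at hv
        simpa using hv
    _ = columnNorm X := h3.symm

theorem integral_traceNorm_le_rowNorm [IsProbabilityMeasure P]
    (hlaw : ∀ i, HasLaw (γ i) (gaussianReal 0 1) P) (hindep : iIndepFun γ P)
    (Y : Fin d → Matrix (Fin n) (Fin n) ℂ) :
    ∫ ω, traceNorm (∑ i, (γ i ω : ℂ) • Y i) ∂P ≤ rowNorm Y := by
  rw [rowNorm_eq_columnNorm]
  refine le_trans (le_of_eq ?_) (integral_traceNorm_le_columnNorm hlaw hindep _)
  congr 1
  ext ω
  rw [← traceNorm_conjTranspose, conjTranspose_sum_smul fun i => γ i ω]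

theorem integral_traceNorm_le_rowColumnNorm [IsProbabilityMeasure P]
    (hlaw : ∀ i, HasLaw (γ i) (gaussianReal 0 1) P) (hindep : iIndepFun γ P)
    (C : Fin d → Matrix (Fin n) (Fin n) ℂ) :
    ∫ ω, traceNorm (∑ i, (γ i ω : ℂ) • C i) ∂P ≤ rowColumnNorm C := by
  refine le_rowColumnNorm fun X Y hC => ?_
  have hX := integrable_traceNorm_sum_smul hlaw X
  have hY := integrable_traceNorm_sum_smul hlaw Y
  refine le_trans (integral_mono (integrable_traceNorm_sum_smul hlaw C) (hX.add hY) fun ω => ?_)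
    ((integral_add hX hY).trans_le (add_le_add (integral_traceNorm_le_columnNorm hlaw hindep X)
      (integral_traceNorm_le_rowNorm hlaw hindep Y)))
  simp only [hC, Pi.add_apply, smul_add, Finset.sum_add_distrib]
  exact traceNorm_add_le _ _

/-! ### The lower bound -/

theorem norm_sum_conjTranspose_mul_sq_le {a : Fin d → Matrix (Fin n) (Fin n) ℂ}
    (ha : ∀ v, ∑ i, ‖op (a i) v‖ ^ 2 ≤ ‖v‖ ^ 2) (v : EuclideanSpace ℂ (Fin n)) :
    ‖∑ i, op ((a i).conjTranspose * a i) v‖ ^ 2 ≤ ‖v‖ ^ 2 := by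
  set w := ∑ i, op ((a i).conjTranspose * a i) v with hw
  have h1 : ‖w‖ ^ 2 = ∑ i, (inner ℂ (op (a i) w) (op (a i) v)).re := by
    rw [← inner_self_eq_norm_sq (𝕜 := ℂ)]
    conv_lhs => rw [hw, ← hw, inner_sum]
    simp only [op_mul_apply, inner_op_conjTranspose_right]
    simp
  have h2 : ‖w‖ ^ 2 ≤ ‖w‖ * ‖v‖ := by
    rw [h1]
    calc ∑ i, (inner ℂ (op (a i) w) (op (a i) v)).re
        ≤ ∑ i, ‖op (a i) w‖ * ‖op (a i) v‖ :=
          Finset.sum_le_sum fun i _ => re_inner_le_norm (𝕜 := ℂ) _ _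
      _ ≤ √(∑ i, ‖op (a i) w‖ ^ 2) * √(∑ i, ‖op (a i) v‖ ^ 2) :=
          Real.sum_mul_le_sqrt_mul_sqrt _ _ _
      _ ≤ ‖w‖ * ‖v‖ :=
          mul_le_mul (Real.sqrt_le_iff.2 ⟨norm_nonneg _, ha w⟩)
            (Real.sqrt_le_iff.2 ⟨norm_nonneg _, ha v⟩) (Real.sqrt_nonneg _) (norm_nonneg _)
  nlinarith [norm_nonneg w, norm_nonneg v, sq_nonneg (‖w‖ - ‖v‖)]

theorem op_conjTranspose_mul_sum_smul (t : Fin d → ℝ) (a : Fin d → Matrix (Fin n) (Fin n) ℂ)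
    (v : EuclideanSpace ℂ (Fin n)) :
    op ((∑ i, (t i : ℂ) • a i).conjTranspose * ∑ i, (t i : ℂ) • a i) v =
      ∑ i, ∑ j, ((t i * t j : ℝ) : ℂ) • op ((a i).conjTranspose * a j) v := by
  rw [op_mul_apply, conjTranspose_sum_smul, op_sum_smul_apply, op_sum_smul_apply]
  refine Finset.sum_congr rfl fun i _ => ?_
  rw [map_sum, Finset.smul_sum]
  refine Finset.sum_congr rfl fun j _ => ?_
  rw [map_smul, smul_smul, op_mul_apply]
  push_cast
  rfl

theorem integrable_norm_op_conjTranspose_mul_sq (hlaw : ∀ i, HasLaw (γ i) (gaussianReal 0 1) P)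
    (a : Fin d → Matrix (Fin n) (Fin n) ℂ) (v : EuclideanSpace ℂ (Fin n)) :
    Integrable (fun ω => ‖op ((∑ i, (γ i ω : ℂ) • a i).conjTranspose *
      ∑ i, (γ i ω : ℂ) • a i) v‖ ^ 2) P := by
  simp_rw [op_conjTranspose_mul_sum_smul fun i => γ i _]
  exact integrable_norm_sum_mul_smul_sq hlaw _

/-- The constant is 1 + 2: the diagonal pairing gives the contraction `∑ a_i* a_i`, the other two at
most `‖v‖²` each. -/
theorem integral_norm_op_conjTranspose_mul_sq_le
    (hlaw : ∀ i, HasLaw (γ i) (gaussianReal 0 1) P) (hindep : iIndepFun γ P)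
    {a : Fin d → Matrix (Fin n) (Fin n) ℂ} (ha : ∀ v, ∑ i, ‖op (a i) v‖ ^ 2 ≤ ‖v‖ ^ 2)
    (ha' : ∀ v, ∑ i, ‖op (a i).conjTranspose v‖ ^ 2 ≤ ‖v‖ ^ 2) (v : EuclideanSpace ℂ (Fin n)) :
    ∫ ω, ‖op ((∑ i, (γ i ω : ℂ) • a i).conjTranspose * ∑ i, (γ i ω : ℂ) • a i) v‖ ^ 2 ∂P ≤
      3 * ‖v‖ ^ 2 := by
  simp_rw [op_conjTranspose_mul_sum_smul fun i => γ i _]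
  refine (integral_norm_sum_mul_smul_sq_le hlaw hindep _).trans ?_
  have h1 := norm_sum_conjTranspose_mul_sq_le ha v
  have h2 : ∑ i, ∑ j, ‖op ((a i).conjTranspose * a j) v‖ ^ 2 ≤ ‖v‖ ^ 2 := by
    -- Summing over `i` first applies `ha'` at each `a_j v`; then `ha` sums over `j`.
    rw [Finset.sum_comm]
    simp_rw [op_mul_apply]
    exact (Finset.sum_le_sum fun j _ => ha' _).trans (ha v)
  linarith

theorem memLp_sub_smoothTruncation [IsProbabilityMeasure P]
    (hlaw : ∀ i, HasLaw (γ i) (gaussianReal 0 1) P)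
    (a : Fin d → Matrix (Fin n) (Fin n) ℂ) (k l : Fin n) :
    MemLp (fun ω => ((∑ i, (γ i ω : ℂ) • a i) -
      (∑ i, (γ i ω : ℂ) • a i).smoothTruncation) k l) 2 P := by
  have hm : AEMeasurable (fun ω i => γ i ω) P :=
    aemeasurable_pi_lambda _ fun i => (hlaw i).aemeasurable
  have hS : MemLp (fun ω => (∑ i, (γ i ω : ℂ) • a i) k l) 2 P := by
    simp_rw [Matrix.sum_apply, Matrix.smul_apply]
    exact memLp_two_sum_smul hlaw _
  have hc : Continuous fun t : Fin d → ℝ => (∑ i, (t i : ℂ) • a i).smoothTruncation k l :=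
    (continuous_smoothTruncation.comp (by fun_prop)).matrix_elem k l
  have hF : MemLp (fun ω => (∑ i, (γ i ω : ℂ) • a i).smoothTruncation k l) 2 P :=
    MemLp.of_bound (hc.measurable.comp_aemeasurable hm).aestronglyMeasurable (√3 / 2)
      (Filter.Eventually.of_forall fun ω => norm_apply_le_of_norm_op_sq_le (by positivity)
        (norm_op_smoothTruncation_sq_le _) k l)
  exact hS.sub hF

theorem integrable_smul_of_memLp_two {p q : Fin n} (hlaw : ∀ i, HasLaw (γ i) (gaussianReal 0 1) P)
    {M : Ω → Matrix (Fin n) (Fin n) ℂ} (hM : MemLp (fun ω => M ω p q) 2 P) (i : Fin d) :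
    Integrable (fun ω => ((γ i ω : ℂ) • M ω) p q) P :=
  (memLp_two_of_hasLaw_gaussianReal (hlaw i)).ofReal.integrable_mul hM

/-- Bessel, the truncation remainder and the fourth moment combine to `3/12 = (1/2)²`. -/
theorem sum_norm_op_entrywiseMean_sq_le [IsProbabilityMeasure P]
    (hlaw : ∀ i, HasLaw (γ i) (gaussianReal 0 1) P) (hindep : iIndepFun γ P)
    {a : Fin d → Matrix (Fin n) (Fin n) ℂ} (ha : ∀ v, ∑ i, ‖op (a i) v‖ ^ 2 ≤ ‖v‖ ^ 2)
    (ha' : ∀ v, ∑ i, ‖op (a i).conjTranspose v‖ ^ 2 ≤ ‖v‖ ^ 2) (v : EuclideanSpace ℂ (Fin n)) :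
    ∑ j, ‖op (entrywiseMean P fun ω => (γ j ω : ℂ) • ((∑ i, (γ i ω : ℂ) • a i) -
      (∑ i, (γ i ω : ℂ) • a i).smoothTruncation)) v‖ ^ 2 ≤ (1 / 2) ^ 2 * ‖v‖ ^ 2 := by
  have hR := memLp_sub_smoothTruncation hlaw a
  have h1 : ∀ j, op (entrywiseMean P fun ω => (γ j ω : ℂ) • ((∑ i, (γ i ω : ℂ) • a i) -
      (∑ i, (γ i ω : ℂ) • a i).smoothTruncation)) v =
      ∫ ω, (γ j ω : ℂ) • op ((∑ i, (γ i ω : ℂ) • a i) -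
        (∑ i, (γ i ω : ℂ) • a i).smoothTruncation) v ∂P := by
    intro j
    rw [op_entrywiseMean fun k l => integrable_smul_of_memLp_two hlaw (hR k l) j]
    simp only [op, map_smul, _root_.smul_apply]
  simp_rw [h1]
  have hZ := memLp_op_apply hR v
  refine (sum_norm_integral_smul_sq_le hlaw hindep hZ).trans ?_
  have h2 := integral_mono (hZ.integrable_norm_pow (by norm_num))
    ((integrable_norm_op_conjTranspose_mul_sq hlaw a v).div_const 12)
    fun ω => norm_op_sub_smoothTruncation_sq_le _ v
  rw [integral_div] at h2
  have h3 := integral_norm_op_conjTranspose_mul_sq_le hlaw hindep ha ha' v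
  refine h2.trans ?_
  linarith

theorem rowColumnNorm_le_integral_traceNorm [IsProbabilityMeasure P]
    (hlaw : ∀ i, HasLaw (γ i) (gaussianReal 0 1) P) (hindep : iIndepFun γ P)
    (C : Fin d → Matrix (Fin n) (Fin n) ℂ) :
    rowColumnNorm C ≤ √3 * ∫ ω, traceNorm (∑ i, (γ i ω : ℂ) • C i) ∂P := by
  obtain ⟨a, ha, ha', haC⟩ := exists_re_sum_trace_mul_eq_rowColumnNorm C
  set S : Ω → Matrix (Fin n) (Fin n) ℂ := fun ω => ∑ i, (γ i ω : ℂ) • a i with hS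
  set R : Ω → Matrix (Fin n) (Fin n) ℂ := fun ω => S ω - (S ω).smoothTruncation with hRdef
  set b : Fin d → Matrix (Fin n) (Fin n) ℂ :=
    fun j => entrywiseMean P fun ω => (γ j ω : ℂ) • R ω with hb
  have hRi : ∀ j k l, Integrable (fun ω => ((γ j ω : ℂ) • R ω) k l) P := fun j k l =>
    integrable_smul_of_memLp_two hlaw (memLp_sub_smoothTruncation hlaw a k l) j
  have hb1 : ∀ v, ∑ j, ‖op (b j) v‖ ^ 2 ≤ (1 / 2) ^ 2 * ‖v‖ ^ 2 :=
    sum_norm_op_entrywiseMean_sq_le hlaw hindep ha ha'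
  -- Adjoints of the `b j` are the same means built from the `(a i)*`, whose two hypotheses are
  -- swapped.
  have hb2 : ∀ v, ∑ j, ‖op (b j).conjTranspose v‖ ^ 2 ≤ (1 / 2) ^ 2 * ‖v‖ ^ 2 := by
    intro v
    have h := sum_norm_op_entrywiseMean_sq_le hlaw hindep (a := fun i => (a i).conjTranspose) ha'
      (by simpa using ha) v
    have : ∀ j, (b j).conjTranspose = entrywiseMean P fun ω => (γ j ω : ℂ) •
        ((∑ i, (γ i ω : ℂ) • (a i).conjTranspose) -
          (∑ i, (γ i ω : ℂ) • (a i).conjTranspose).smoothTruncation) := by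
      intro j
      rw [hb, conjTranspose_entrywiseMean]
      congr 1
      ext1 ω
      rw [← conjTranspose_sum_smul fun i => γ i ω, smoothTruncation_conjTranspose,
        ← Matrix.conjTranspose_sub, Matrix.conjTranspose_smul]
      simp [hRdef, hS]
    simpa only [this] using h
  have hbC := re_sum_trace_mul_le_rowColumnNorm b C (by norm_num) hb1 hb2
  have hi : ∀ i j, Integrable (fun ω => γ i ω * γ j ω * (a i * C j).trace.re) P := fun i j =>
    ((memLp_two_of_hasLaw_gaussianReal (hlaw i)).integrable_mul
      (memLp_two_of_hasLaw_gaussianReal (hlaw j))).mul_const _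
  have hexp : ∀ ω, (S ω * ∑ j, (γ j ω : ℂ) • C j).trace.re =
      ∑ i, ∑ j, γ i ω * γ j ω * (a i * C j).trace.re := by
    intro ω
    simp only [hS, Finset.sum_mul, Finset.mul_sum, Matrix.trace_sum, Complex.re_sum,
      Matrix.smul_mul, Matrix.mul_smul, Matrix.trace_smul, smul_eq_mul, Complex.re_ofReal_mul]
    rw [Finset.sum_comm]
    refine Finset.sum_congr rfl fun i _ => Finset.sum_congr rfl fun j _ => ?_
    ring
  have hSint : ∫ ω, (S ω * ∑ j, (γ j ω : ℂ) • C j).trace.re ∂P = rowColumnNorm C := by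
    simp_rw [hexp]
    rw [integral_finsetSum _ fun i _ => integrable_finsetSum _ fun j _ => hi i j, ← haC,
      Complex.re_sum]
    refine Finset.sum_congr rfl fun i _ => ?_
    rw [integral_finsetSum _ fun j _ => hi i j]
    simp_rw [integral_mul_const, integral_mul_gaussianReal hlaw hindep]
    simp
  have hSi : Integrable (fun ω => (S ω * ∑ j, (γ j ω : ℂ) • C j).trace.re) P := by
    simp_rw [hexp]
    exact integrable_finsetSum _ fun i _ => integrable_finsetSum _ fun j _ => hi i j
  have hexpR : ∀ ω, (R ω * ∑ j, (γ j ω : ℂ) • C j).trace =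
      ∑ j, (((γ j ω : ℂ) • R ω) * C j).trace := by
    intro ω
    simp [Finset.mul_sum, Matrix.trace_sum]
  have hRi' : Integrable (fun ω => (R ω * ∑ j, (γ j ω : ℂ) • C j).trace) P := by
    simp_rw [hexpR]
    exact integrable_finsetSum _ fun j _ => integrable_trace_mul (hRi j) (C j)
  have hRint : ∫ ω, (R ω * ∑ j, (γ j ω : ℂ) • C j).trace.re ∂P =
      (∑ j, (b j * C j).trace).re := by
    have h1 := integral_re hRi'
    simp only [RCLike.re_to_complex] at h1
    rw [h1]
    simp_rw [hexpR]
    rw [integral_finsetSum _ fun j _ => integrable_trace_mul (hRi j) (C j)]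
    simp_rw [hb, trace_entrywiseMean_mul (hRi _)]
  have hCi := integrable_traceNorm_sum_smul hlaw C
  have hRre : Integrable (fun ω => (R ω * ∑ j, (γ j ω : ℂ) • C j).trace.re) P := hRi'.re
  have hmain := integral_mono hSi ((hCi.const_mul (√3 / 2)).add hRre) fun ω => by
    have h1 := re_trace_mul_le_traceNorm (S ω).smoothTruncation (∑ j, (γ j ω : ℂ) • C j)
      (by positivity) (norm_op_smoothTruncation_sq_le (S ω))
    have h2 : S ω = (S ω).smoothTruncation + R ω := by simp [hRdef]
    simp only [Pi.add_apply]
    conv_lhs => rw [h2, add_mul, Matrix.trace_add, Complex.add_re]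
    exact add_le_add_left h1 _
  rw [hSint, integral_add' (hCi.const_mul (√3 / 2)) hRre, integral_const_mul, hRint] at hmain
  -- Half of `rowColumnNorm C`, from `hbC`, is absorbed on the left.
  linarith

end Khintchine

theorem corollary3p4 {Ω : Type*} [MeasurableSpace Ω] (P : MeasureTheory.Measure Ω)
    [MeasureTheory.IsProbabilityMeasure P] (n d : ℕ) (γ : Fin d → Ω → ℝ)
    (hlaw : ∀ i, ProbabilityTheory.HasLaw (γ i) (ProbabilityTheory.gaussianReal 0 1) P)
    (hindep : ProbabilityTheory.iIndepFun γ P)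
    (C : Fin d → Matrix (Fin n) (Fin n) ℂ) :
    MeasureTheory.Integrable (fun ω => traceNorm (∑ i, (γ i ω : ℂ) • C i)) P ∧
    1 / Real.sqrt 3 * rowColumnNorm C ≤ ∫ ω, traceNorm (∑ i, (γ i ω : ℂ) • C i) ∂P ∧
    ∫ ω, traceNorm (∑ i, (γ i ω : ℂ) • C i) ∂P ≤ rowColumnNorm C := by
  refine ⟨integrable_traceNorm_sum_smul hlaw C, ?_,
    integral_traceNorm_le_rowColumnNorm hlaw hindep C⟩
  rw [one_div, inv_mul_le_iff₀ (by positivity)]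
  exact rowColumnNorm_le_integral_traceNorm hlaw hindep C
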